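/- Let $k,n\ge 1$ be integers, put $m=2k$, and let $Q\in\mathbb Z^{m,m}_{\rm sym}$ be the matrix, relative to a given $\mathbb Z$-basis, of a positive definite even integral quadratic form on a lattice $L$ of rank $m$ (even integral: an integral symmetric matrix with even diagonal entries). Let $N$ be the level of $Q$, i.e. the smallest positive integer such that $NQ^{-1}$ is even integral. For a square matrix $A$ put $\mathbf e\{A\}=\exp(\pi i\,\mathrm{Tr}A)$, for a matrix $U$ with $m$ rows put $Q(U)={}^tUQU$ and $Q^{-1}(U)={}^tUQ^{-1}U$, and for $\tau$ in the Siegel upper half-space $\mathfrak h_{(n)}=\{X+iY: X,Y\in\mathbb R^{n,n}_{\rm sym},\ Y>0\}$ let $$\theta^{(n)}(L;\tau)=\sum_{U\in\mathbb Z^{m,n}}\mathbf e\{Q(U)\tau\},$$ a series which converges absolutely. For $\gamma=\begin{pmatrix}A&B\\C&D\end{pmatrix}\in Sp_n(\mathbb Z)$ put $$\theta^{(n)}(L;\tau)|\gamma=\det(C\tau+D)^{-k}\,\theta^{(n)}\bigl(L;(A\tau+B)(C\tau+D)^{-1}\bigr).$$ Let $M\in\mathbb Z^{n,n}$ be such that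 $\begin{pmatrix}I&0\\-M&I\end{pmatrix}\in Sp_n(\mathbb Z)$ (equivalently, $M$ is symmetric). Then $$\lim_{\tau\to i\infty}\theta^{(n)}(L;\tau)|\begin{pmatrix}I&0\\-M&I\end{pmatrix}=\prod_{\substack{q\ \text{prime}\\ q^e\parallel N,\ e\ge1}}a_q(L,M),$$ where, for a prime $q$ with $q^e\parallel N$, $$a_q(L,M)=q^{-emn}\sum_{V\in\mathbb Z^{m,n}/q^e\mathbb Z^{m,n}}\mathbf e\{N^2\,Q^{-1}(V)\,M/q^{2e}\}.$$ Here $\tau\to i\infty$ means that $\tau$ varies in $\mathfrak h_{(n)}$ so that the smallest eigenvalue of $\mathrm{Im}\,\tau$ tends to $\infty$, with no restriction on $\mathrm{Re}\,\tau$. -/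

import Mathlib

open Filter Topology

noncomputable section

namespace SiegelTheta

/-- `Q(U) = ᵗU Q U`. -/
def quadVal {R : Type*} [CommRing R] {m n : ℕ} (Q : Matrix (Fin m) (Fin m) R)
    (U : Matrix (Fin m) (Fin n) R) : Matrix (Fin n) (Fin n) R :=
  U.transpose * Q * U

/-- An integral symmetric matrix with even diagonal entries. -/
def IsEvenIntegral {m : ℕ} (Q : Matrix (Fin m) (Fin m) ℤ) : Prop :=
  Q.IsSymm ∧ ∀ i, Even (Q i i)

/-- `Q` is positive definite on the lattice: `Q(x) > 0` for every nonzero integral vector `x`. -/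
def IsPositiveDefinite {m : ℕ} (Q : Matrix (Fin m) (Fin m) ℤ) : Prop :=
  ∀ x : Fin m → ℤ, x ≠ 0 → 0 < x ⬝ᵥ (Q.mulVec x)

/-- The inverse `Q⁻¹`, a rational matrix. -/
def ratInv {m : ℕ} (Q : Matrix (Fin m) (Fin m) ℤ) : Matrix (Fin m) (Fin m) ℚ :=
  (Q.map (Int.cast : ℤ → ℚ))⁻¹

/-- The positive integers `N` for which `N Q⁻¹` is even integral. -/
def levelSet {m : ℕ} (Q : Matrix (Fin m) (Fin m) ℤ) : Set ℕ :=
  {N | 0 < N ∧ ∃ A : Matrix (Fin m) (Fin m) ℤ,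
    IsEvenIntegral A ∧ (N : ℚ) • ratInv Q = A.map (Int.cast : ℤ → ℚ)}

/-- The level of `Q`: the smallest positive integer `N` such that `N Q⁻¹` is even integral. -/
def level {m : ℕ} (Q : Matrix (Fin m) (Fin m) ℤ) : ℕ := sInf (levelSet Q)

/-- For the matrices considered here the level is a genuine minimum. -/
theorem level_isLeast {m : ℕ} {Q : Matrix (Fin m) (Fin m) ℤ} (hpos : IsPositiveDefinite Q)
    (heven : IsEvenIntegral Q) : IsLeast (levelSet Q) (level Q) := by
  have hdet : Q.det ≠ 0 := by
    intro h
    obtain ⟨v, hv, hQv⟩ := Matrix.exists_mulVec_eq_zero_iff.mpr h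
    have := hpos v hv
    simp [hQv] at this
  have hne : (levelSet Q).Nonempty := by
    refine ⟨(2 * Q.det).natAbs, by simpa using hdet, (2 * Q.det.sign) • Q.adjugate, ⟨?_, ?_⟩, ?_⟩
    · have : Q.adjugate.IsSymm := by
        have h := Matrix.adjugate_transpose Q
        rw [heven.1] at h
        exact h
      exact this.smul _
    · intro i
      simp [mul_assoc]
    · have hmap : Q.map (Int.cast : ℤ → ℚ) = (Int.castRingHom ℚ).mapMatrix Q := rfl
      have hd : (Q.map (Int.cast : ℤ → ℚ)).det = (Q.det : ℚ) := by
        rw [hmap, ← RingHom.map_det]; rfl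
      have ha : (Q.map (Int.cast : ℤ → ℚ)).adjugate = Q.adjugate.map (Int.cast : ℤ → ℚ) := by
        rw [hmap, ← RingHom.map_adjugate]; rfl
      have hd0 : (Q.det : ℚ) ≠ 0 := by exact_mod_cast hdet
      have hs : (((2 * Q.det).natAbs : ℕ) : ℚ) = 2 * (Q.det.sign : ℚ) * (Q.det : ℚ) := by
        have h1 : (((2 * Q.det).natAbs : ℕ) : ℤ) = 2 * Q.det.sign * Q.det := by
          rw [Int.natAbs_mul, mul_assoc, Int.sign_mul_self_eq_natAbs]; simp
        have h2 := congrArg (Int.cast : ℤ → ℚ) h1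
        rw [Int.cast_natCast] at h2
        rw [h2]
        push_cast
        ring
      rw [ratInv, Matrix.inv_def, hd, ha, hs, Ring.inverse_eq_inv']
      ext i j
      simp only [Matrix.smul_apply, Matrix.map_apply, smul_eq_mul, Int.cast_mul, Int.cast_ofNat]
      field_simp
  exact ⟨Nat.sInf_mem hne, fun N hN => Nat.sInf_le hN⟩

/-- `e{A} = exp(π i Tr A)`. -/
def expTrace {n : ℕ} (A : Matrix (Fin n) (Fin n) ℂ) : ℂ :=
  Complex.exp (Real.pi * Complex.I * A.trace)

/-- The Siegel upper half-space of degree `n`: the `X + iY` with `X`, `Y` real symmetric, `Y > 0`. -/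
def siegelUpperHalfSpace (n : ℕ) : Set (Matrix (Fin n) (Fin n) ℂ) :=
  {τ | τ.IsSymm ∧ (τ.map Complex.im).PosDef}

/-- The summand `e{Q(U)τ}` of the theta series. -/
def thetaTerm {m n : ℕ} (Q : Matrix (Fin m) (Fin m) ℤ) (τ : Matrix (Fin n) (Fin n) ℂ)
    (U : Matrix (Fin m) (Fin n) ℤ) : ℂ :=
  expTrace ((quadVal Q U).map (Int.cast : ℤ → ℂ) * τ)

/-- The degree `n` Siegel theta series `θ⁽ⁿ⁾(L;τ) = ∑_U e{Q(U)τ}`, `U` over `ℤ^{m,n}`. -/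
def theta {m n : ℕ} (Q : Matrix (Fin m) (Fin m) ℤ) (τ : Matrix (Fin n) (Fin n) ℂ) : ℂ :=
  ∑' U : Matrix (Fin m) (Fin n) ℤ, thetaTerm Q τ U

/-- The weight `k` action of `γ = (A B; C D)`:
`(f|γ)(τ) = det(Cτ+D)^{-k} f((Aτ+B)(Cτ+D)⁻¹)`. -/
def slash {n : ℕ} (k : ℕ) (f : Matrix (Fin n) (Fin n) ℂ → ℂ)
    (γ : Matrix (Fin n ⊕ Fin n) (Fin n ⊕ Fin n) ℤ) (τ : Matrix (Fin n) (Fin n) ℂ) : ℂ :=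
  let A := γ.toBlocks₁₁.map (Int.cast : ℤ → ℂ)
  let B := γ.toBlocks₁₂.map (Int.cast : ℤ → ℂ)
  let C := γ.toBlocks₂₁.map (Int.cast : ℤ → ℂ)
  let D := γ.toBlocks₂₂.map (Int.cast : ℤ → ℂ)
  (C * τ + D).det ^ (-(k : ℤ)) * f ((A * τ + B) * (C * τ + D)⁻¹)

/-- The filter `τ → i∞` on the Siegel upper half-space: the smallest eigenvalue of `Im τ` tends
to infinity, that is, eventually `Im τ ≥ c I` for every real `c`; `Re τ` is unrestricted. -/
def atIInfty (n : ℕ) : Filter (Matrix (Fin n) (Fin n) ℂ) :=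
  ⨅ c : ℝ, 𝓟 {τ | τ ∈ siegelUpperHalfSpace n ∧
    (τ.map Complex.im - c • (1 : Matrix (Fin n) (Fin n) ℝ)).PosSemidef}

/-- The normalized generalized Gauss sum
`a_q(L,M) = q^{-emn} ∑_V e{N² Q⁻¹(V) M / q^{2e}}`, where `N` is the level of `Q` and `q^e ‖ N`.
The sum is over `ℤ^{m,n} / q^e ℤ^{m,n}`, each class being represented by its matrix with entries
in `{0, …, q^e - 1}`. -/
def gaussSum {m n : ℕ} (Q : Matrix (Fin m) (Fin m) ℤ) (M : Matrix (Fin n) (Fin n) ℤ)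
    (q : ℕ) : ℂ :=
  let N := level Q
  let e := N.factorization q
  ((q : ℂ) ^ (e * m * n))⁻¹ *
    ∑ V : Matrix (Fin m) (Fin n) (Fin (q ^ e)),
      expTrace (((((N : ℚ) ^ 2 / (q : ℚ) ^ (2 * e)) •
        (quadVal (ratInv Q) (V.map fun v => ((v : ℕ) : ℚ)) * M.map (Int.cast : ℤ → ℚ))).map
          (Rat.cast : ℚ → ℂ)))

end SiegelTheta

end

noncomputable section

namespace SiegelTheta

open MeasureTheory Complex

/-! Put `σ = M - τ⁻¹`. The transformed point is `τ(-Mτ+1)⁻¹ = -σ⁻¹`, so inversion of theta series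
(`tsum_expTrace_inversion`) turns the left side into an explicit factor times `∑_W e{Q⁻¹(W)σ}`. Let
`A = NQ⁻¹`, which is even integral. Since `M` is symmetric, `Tr(ᵗW A W M)` is even, so `e{Q⁻¹(W)M}`
depends only on `W` mod `N`. Hence the sum splits over residues `V` mod `N` into constants
`e{Q⁻¹(V)M}` times theta series of the cosets `V + Nℤ^{m,n}` at `-τ⁻¹`. A second inversion
(`tsum_residue_class`) brings these back to `τ`, as series in `N⁻²Q(U)τ` twisted by additive
characters. The determinant factors cancel, leaving only `N^{-mn}` (`slash_theta_eq`).

As `τ → i∞`, dominated convergence leaves only the term `U = 0` of each twisted series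
(`tendsto_twisted_theta`), so the limit is `N^{-mn} ∑_V e{Q⁻¹(V)M}`. Writing `V = d₂V₁ + d₁V₂` for
coprime `d₁`, `d₂` makes the cross terms disappear modulo `2N`, and the Gauss sum factors over the
prime powers exactly dividing `N` (`normalizedGaussSum_eq_prod`).

Inversion itself is Poisson summation for a Gaussian. A real congruence diagonalizes `σ`, and `S =
ᵗRR` does the same for the quadratic form, so vectorization reduces the Fourier transform to a
product of one-variable integrals. -/

/-! ### Unfolding and Poisson summation on `ℝ^ι`. -/

/-- The real vector underlying an integral vector. -/
def intVec {ι : Type*} (v : ι → ℤ) : ι → ℝ := fun i => (v i : ℝ)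

/-- The half-open box `∏ (v i, v i + 1]`. -/
def unitBox {ι : Type*} (v : ι → ℤ) : Set (ι → ℝ) :=
  {x | ∀ i, x i ∈ Set.Ioc (v i : ℝ) (v i + 1)}

theorem measurableSet_unitBox {ι : Type*} [Fintype ι] (v : ι → ℤ) :
    MeasurableSet (unitBox v) :=
  MeasurableSet.univ_pi' fun _ => measurableSet_Ioc

theorem pairwise_disjoint_unitBox {ι : Type*} :
    Pairwise (Function.onFun Disjoint (unitBox (ι := ι))) := by
  intro v w hvw
  refine Set.disjoint_left.mpr fun x hx hy => hvw ?_
  funext i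
  have h1 := hx i
  have h2 := hy i
  simp only [Set.mem_Ioc] at h1 h2
  have h3 : v i < w i + 1 := by exact_mod_cast h1.1.trans_le h2.2
  have h4 : w i < v i + 1 := by exact_mod_cast h2.1.trans_le h1.2
  omega

theorem iUnion_unitBox {ι : Type*} : ⋃ v, unitBox (ι := ι) v = Set.univ := by
  -- The boxes are open on the left, so the corner is `⌈x⌉ - 1` rather than `⌊x⌋`.
  refine Set.eq_univ_of_forall fun x => Set.mem_iUnion.mpr ⟨fun i => ⌈x i⌉ - 1, fun i => ?_⟩
  have h1 := Int.ceil_lt_add_one (x i)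
  have h2 := Int.le_ceil (x i)
  simp only [Set.mem_Ioc]
  push_cast
  constructor <;> linarith

theorem preimage_add_unitBox {ι : Type*} (v : ι → ℤ) :
    (fun x : ι → ℝ => x + intVec v) ⁻¹' unitBox v = unitBox 0 := by
  ext x
  simp only [unitBox, Set.mem_preimage, Set.mem_ofPred_eq, Set.mem_Ioc, Pi.add_apply, intVec,
    Pi.zero_apply, Int.cast_zero]
  refine forall_congr' fun i => ⟨fun h => ⟨?_, ?_⟩, fun h => ⟨?_, ?_⟩⟩ <;> linarith [h.1, h.2]

theorem norm_le_one_of_mem_unitBox {ι : Type*} [Fintype ι] {x : ι → ℝ}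
    (hx : x ∈ unitBox (0 : ι → ℤ)) : ‖x‖ ≤ 1 := by
  refine (pi_norm_le_iff_of_nonneg zero_le_one).mpr fun i => ?_
  have h := hx i
  simp only [Set.mem_Ioc, Pi.zero_apply, Int.cast_zero, zero_add] at h
  rw [Real.norm_of_nonneg h.1.le]
  exact h.2

theorem volume_unitBox {ι : Type*} [Fintype ι] : volume (unitBox (0 : ι → ℤ)) = 1 := by
  have : unitBox (0 : ι → ℤ) = Set.univ.pi fun _ => Set.Ioc 0 1 := by
    ext x; simp [unitBox]
  rw [this, Real.volume_pi_Ioc]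
  simp

theorem setIntegral_unitBox {ι : Type*} [Fintype ι] {E : Type*} [NormedAddCommGroup E]
    [NormedSpace ℝ E] (g : (ι → ℝ) → E) (v : ι → ℤ) :
    ∫ x in unitBox v, g x = ∫ x in unitBox 0, g (x + intVec v) := by
  rw [← preimage_add_unitBox v]
  exact ((measurePreserving_add_right volume (intVec v)).setIntegral_preimage_emb
    (measurableEmbedding_addRight _) g (unitBox v)).symm

/-- Unfolding: the integral over the unit box of a periodization is the full integral. -/
theorem setIntegral_tsum_add_intVec {ι : Type*} [Fintype ι] {g : (ι → ℝ) → ℂ}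
    (hg : Continuous g) {u : (ι → ℤ) → ℝ} (hu : Summable u)
    (hb : ∀ x, ‖x‖ ≤ 1 → ∀ v, ‖g (x + intVec v)‖ ≤ u v) :
    ∫ x in unitBox 0, ∑' v, g (x + intVec v) = ∫ x, g x := by
  have hint : ∀ v, IntegrableOn (fun x => g (x + intVec v)) (unitBox 0) := fun v =>
    Integrable.mono' (g := fun _ => u v) (integrableOn_const (by simp [volume_unitBox]))
      (hg.comp (continuous_add_const _)).aestronglyMeasurable
      ((ae_restrict_iff' (measurableSet_unitBox 0)).mpr
        (Eventually.of_forall fun x hx => hb x (norm_le_one_of_mem_unitBox hx) v))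
  have hsum : Summable fun v => ∫ x in unitBox 0, ‖g (x + intVec v)‖ := by
    refine Summable.of_nonneg_of_le (fun v => integral_nonneg fun _ => norm_nonneg _)
      (fun v => ?_) hu
    calc ∫ x in unitBox 0, ‖g (x + intVec v)‖ ≤ ∫ x in unitBox (0 : ι → ℤ), u v :=
          setIntegral_mono_on (hint v).norm (integrableOn_const (by simp [volume_unitBox]))
            (measurableSet_unitBox 0) fun x hx => hb x (norm_le_one_of_mem_unitBox hx) v
      _ = u v := by simp [Measure.real, volume_unitBox]
  have hgi : ∀ v, IntegrableOn g (unitBox v) := fun v => by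
    have h := (measurePreserving_add_right volume (intVec v)).integrableOn_comp_preimage
      (measurableEmbedding_addRight (intVec v)) (f := g) (s := unitBox v)
    rw [preimage_add_unitBox] at h
    exact h.mp (hint v)
  have hgu : IntegrableOn g (⋃ v, unitBox v) :=
    integrableOn_iUnion_of_summable_integral_norm hgi
      (by simpa only [setIntegral_unitBox (fun x => ‖g x‖)] using hsum)
  have h1 := (hasSum_integral_iUnion measurableSet_unitBox pairwise_disjoint_unitBox hgu).tsum_eq
  have h2 := (hasSum_integral_of_summable_integral_norm hint hsum).tsum_eq
  rw [iUnion_unitBox, setIntegral_univ] at h1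
  rw [← h1, ← h2]
  exact tsum_congr fun v => (setIntegral_unitBox g v).symm

theorem mFourier_coe {ι : Type*} [Fintype ι] (w : ι → ℤ) (x : ι → ℝ) :
    UnitAddTorus.mFourier w (fun i => (x i : UnitAddCircle)) =
      cexp (2 * Real.pi * I * ∑ i, (w i : ℂ) * x i) := by
  simp only [UnitAddTorus.mFourier, ContinuousMap.coe_mk, fourier_coe_apply, Finset.mul_sum,
    Complex.exp_sum]
  refine Finset.prod_congr rfl fun i _ => ?_
  congr 1
  push_cast
  ring

theorem cexp_add_intVec {ι : Type*} [Fintype ι] (w v : ι → ℤ) (x : ι → ℝ) :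
    cexp (2 * Real.pi * I * ∑ i, (w i : ℂ) * ((x + intVec v) i : ℝ)) =
      cexp (2 * Real.pi * I * ∑ i, (w i : ℂ) * x i) := by
  rw [Complex.exp_eq_exp_iff_exists_int]
  refine ⟨∑ i, w i * v i, ?_⟩
  simp only [Pi.add_apply, intVec, Complex.ofReal_add, mul_add, Finset.sum_add_distrib]
  push_cast
  ring

/-- **Poisson summation** on `ℝ^ι`. -/
theorem hasSum_poisson {ι : Type*} [Fintype ι] {f : (ι → ℝ) → ℂ} (hf : Continuous f)
    (hb : ∀ R : ℝ, ∃ u : (ι → ℤ) → ℝ, Summable u ∧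
      ∀ x, ‖x‖ ≤ R → ∀ v, ‖f (x + intVec v)‖ ≤ u v)
    (hs : Summable fun w : ι → ℤ =>
      ∫ x : ι → ℝ, cexp (2 * Real.pi * I * ∑ i, ((-w) i : ℂ) * x i) * f x) (V : ι → ℝ) :
    HasSum (fun w : ι → ℤ =>
      (∫ x : ι → ℝ, cexp (2 * Real.pi * I * ∑ i, ((-w) i : ℂ) * x i) * f x) *
        cexp (2 * Real.pi * I * ∑ i, (w i : ℂ) * V i)) (∑' v, f (V + intVec v)) := by
  set G : (ι → ℝ) → ℂ := fun x => ∑' v, f (x + intVec v) with hG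
  -- Continuity is local: on the unit ball around `x` the bound for radius `‖x‖ + 1` gives uniform
  -- convergence.
  have hGc : Continuous G := by
    refine continuous_iff_continuousAt.mpr fun x => ?_
    obtain ⟨u, hu, hub⟩ := hb (‖x‖ + 1)
    have : ContinuousOn G (Metric.ball x 1) := by
      refine continuousOn_tsum
        (fun v => (hf.comp (continuous_add_const _)).continuousOn) hu fun v y hy => hub y ?_ v
      have := norm_le_norm_add_norm_sub' y x
      have h3 : ‖y - x‖ < 1 := by simpa [dist_eq_norm] using hy
      rw [norm_sub_rev] at this
      linarith [norm_sub_rev x y]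
    exact this.continuousAt (Metric.ball_mem_nhds x one_pos)
  have hGp : ∀ x v, G (x + intVec v) = G x := fun x v => by
    refine Eq.trans (tsum_congr fun w => ?_)
      ((Equiv.addLeft v).tsum_eq (fun w => f (x + intVec w)))
    congr 1
    ext i
    simp [intVec, add_assoc]
  -- The periodic function `G` descends to a continuous function `F` on the torus, since `ℝ^ι` maps
  -- onto it by a quotient map.
  have hmk' : IsOpenQuotientMap fun (x : ι → ℝ) i => (x i : UnitAddCircle) :=
    IsOpenQuotientMap.piMap fun _ => QuotientAddGroup.isOpenQuotientMap_mk
  let mk : C(ι → ℝ, UnitAddTorus ι) := ⟨fun x i => (x i : UnitAddCircle), hmk'.continuous⟩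
  have hmk : IsOpenQuotientMap mk := hmk'
  have hfac : ∀ x y, mk x = mk y → G x = G y := by
    intro x y hxy
    have : ∀ i, ∃ n : ℤ, y i = x i + n := fun i => by
      have h : (x i : UnitAddCircle) = (y i : UnitAddCircle) := congrFun hxy i
      rw [eq_comm, ← sub_eq_zero, ← AddCircle.coe_sub, AddCircle.coe_eq_zero_iff] at h
      obtain ⟨n, hn⟩ := h
      exact ⟨n, by simp at hn; linarith⟩
    choose v hv using this
    rw [show y = x + intVec v from funext hv, hGp]
  let F : C(UnitAddTorus ι, ℂ) :=
    ⟨hmk.isQuotientMap.lift ⟨G, hGc⟩ fun x y h => hfac x y h, ContinuousMap.continuous _⟩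
  have hF : ∀ x, F (mk x) = G x := fun x =>
    DFunLike.congr_fun (hmk.isQuotientMap.lift_comp ⟨G, hGc⟩ fun x y h => hfac x y h) x
  -- The character is invariant under integral translations, so it goes inside the periodization and
  -- the box integral unfolds to the Fourier transform of `f`.
  have hcoeff : ∀ w, UnitAddTorus.mFourierCoeff F w =
      ∫ x : ι → ℝ, cexp (2 * Real.pi * I * ∑ i, ((-w) i : ℂ) * x i) * f x := by
    intro w
    rw [UnitAddTorus.mFourierCoeff_eq_integral F w 0]
    have hbox : {x : ι → ℝ | ∀ i, x i ∈ Set.Ioc ((0 : ι → ℝ) i) ((0 : ι → ℝ) i + 1)} =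
        unitBox 0 := by
      ext x; simp [unitBox]
    have hn : ∀ x : ι → ℝ, ‖cexp (2 * Real.pi * I * ∑ i, ((-w) i : ℂ) * x i)‖ = 1 := fun x => by
      rw [Complex.norm_exp]
      simp
    obtain ⟨u, hu, hub⟩ := hb 1
    rw [hbox, ← setIntegral_tsum_add_intVec (by fun_prop) hu
      (fun x hx v => by rw [norm_mul, hn, one_mul]; exact hub x hx v)]
    refine integral_congr_ae (Eventually.of_forall fun x => ?_)
    simp only [smul_eq_mul]
    have h1 := mFourier_coe (-w) x
    have h2 : F (fun i => (x i : UnitAddCircle)) = G x := hF x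
    rw [h1, h2, hG, ← tsum_mul_left]
    refine tsum_congr fun v => ?_
    have h3 := cexp_add_intVec (-w) v x
    simp only [Pi.neg_apply, Int.cast_neg] at h3 ⊢
    rw [h3]
  have hsum := UnitAddTorus.hasSum_mFourier_series_apply_of_summable (f := F)
    (by rw [show UnitAddTorus.mFourierCoeff F = _ from funext hcoeff]; exact hs) (mk V)
  rw [hF] at hsum
  convert! hsum using 2 with w
  rw [hcoeff, smul_eq_mul]
  exact congrArg _ (mFourier_coe w V).symm

/-! ### Gaussians: bounds, Fourier transform, Poisson summation. -/

theorem summable_prod_pi {ι κ : Type*} [Fintype ι] {g : ι → κ → ℝ} (h0 : ∀ i j, 0 ≤ g i j)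
    (hg : ∀ i, Summable (g i)) : Summable fun v : ι → κ => ∏ i, g i (v i) := by
  classical
  refine summable_of_sum_le (c := ∏ i, ∑' j, g i j)
    (fun v => Finset.prod_nonneg fun i _ => h0 i _) fun s => ?_
  let t : ι → Finset κ := fun i => s.image fun v => v i
  calc ∑ v ∈ s, ∏ i, g i (v i) ≤ ∑ v ∈ Fintype.piFinset t, ∏ i, g i (v i) :=
        Finset.sum_le_sum_of_subset_of_nonneg
          (fun v hv => Fintype.mem_piFinset.mpr fun i => Finset.mem_image_of_mem _ hv)
          fun v _ _ => Finset.prod_nonneg fun i _ => h0 i _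
    _ = ∏ i, ∑ j ∈ t i, g i j := (Finset.prod_univ_sum t g).symm
    _ ≤ ∏ i, ∑' j, g i j := Finset.prod_le_prod
        (fun i _ => Finset.sum_nonneg fun j _ => h0 i j)
        fun i _ => (hg i).sum_le_tsum _ fun j _ => h0 i j

/-- The one-variable series is Jacobi's theta at `z = 0`, `τ = ia/π`; the general one is a product
of these. -/
theorem summable_exp_neg_mul_sum_sq {ι : Type*} [Fintype ι] {a : ℝ} (ha : 0 < a) :
    Summable fun v : ι → ℤ => Real.exp (-a * ∑ i, (v i : ℝ) ^ 2) := by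
  have h1 : Summable fun n : ℤ => Real.exp (-a * (n : ℝ) ^ 2) := by
    have h := ((summable_jacobiTheta₂_term_iff 0 ((a / Real.pi : ℝ) * I)).mpr
      (by simpa using div_pos ha Real.pi_pos)).norm
    refine h.congr fun n => ?_
    rw [jacobiTheta₂_term, mul_zero, zero_add, Complex.norm_exp]
    congr 1
    have : Real.pi * I * (n : ℂ) ^ 2 * ((a / Real.pi : ℝ) * I) = ((-a * (n : ℝ) ^ 2 : ℝ) : ℂ) := by
      have := Real.pi_ne_zero
      push_cast
      field_simp
      rw [I_sq]
      ring
    rw [this, ofReal_re]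
  refine (summable_prod_pi (ι := ι) (fun _ _ => (Real.exp_pos _).le) fun _ => h1).congr fun v => ?_
  rw [← Real.exp_sum, Finset.mul_sum]

/-- Cauchy–Schwarz applied to `x = P⁻¹y`, with each `y j` weighted by `√(β j)`. The constant is `(C
+ 1)⁻¹` because `C` may vanish when `ι` is empty. -/
theorem exists_mul_sum_sq_le {ι : Type*} [Fintype ι] [DecidableEq ι] {P : Matrix ι ι ℝ}
    (hP : P.det ≠ 0) {β : ι → ℝ} (hβ : ∀ i, 0 < β i) :
    ∃ δ > 0, ∀ x : ι → ℝ, δ * ∑ i, x i ^ 2 ≤ ∑ i, β i * (P.mulVec x) i ^ 2 := by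
  set C : ℝ := ∑ i, ∑ j, (P⁻¹ i j / √(β j)) ^ 2 with hC
  have hC0 : 0 ≤ C := Finset.sum_nonneg fun i _ => Finset.sum_nonneg fun j _ => sq_nonneg _
  refine ⟨(C + 1)⁻¹, by positivity, fun x => ?_⟩
  set y := P.mulVec x with hy
  have hx : x = P⁻¹.mulVec y := by
    rw [hy, Matrix.mulVec_mulVec, Matrix.nonsing_inv_mul _ (isUnit_iff_ne_zero.mpr hP),
      Matrix.one_mulVec]
  set q := ∑ i, β i * y i ^ 2
  have hq : 0 ≤ q := Finset.sum_nonneg fun i _ => mul_nonneg (hβ i).le (sq_nonneg _)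
  have h : ∑ i, x i ^ 2 ≤ C * q := by
    rw [hC, Finset.sum_mul]
    refine Finset.sum_le_sum fun i _ => ?_
    have hi : x i = ∑ j, (P⁻¹ i j / √(β j)) * (√(β j) * y j) := by
      conv_lhs => rw [hx]
      refine Finset.sum_congr rfl fun j _ => ?_
      have := (Real.sqrt_pos.mpr (hβ j)).ne'
      field_simp
    have hqe : q = ∑ j, (√(β j) * y j) ^ 2 :=
      Finset.sum_congr rfl fun j _ => by rw [mul_pow, Real.sq_sqrt (hβ j).le]
    rw [hi, hqe]
    exact Finset.sum_mul_sq_le_sq_mul_sq _ _ _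
  rw [inv_mul_le_iff₀ (by positivity)]
  nlinarith

/-- The Gaussian `exp(-π ∑ bᵢ (Px)ᵢ²)`. -/
def gaussian {ι : Type*} [Fintype ι] (P : Matrix ι ι ℝ) (b : ι → ℂ) (x : ι → ℝ) : ℂ :=
  cexp (-Real.pi * ∑ i, b i * ((P.mulVec x i : ℝ) : ℂ) ^ 2)

theorem continuous_gaussian {ι : Type*} [Fintype ι] (P : Matrix ι ι ℝ) (b : ι → ℂ) :
    Continuous (gaussian P b) := by
  have : ∀ i, Continuous fun x => P.mulVec x i := fun i =>
    (continuous_apply i).comp (Continuous.matrix_mulVec continuous_const continuous_id)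
  unfold gaussian
  fun_prop

theorem norm_gaussian {ι : Type*} [Fintype ι] (P : Matrix ι ι ℝ) (b : ι → ℂ) (x : ι → ℝ) :
    ‖gaussian P b x‖ = Real.exp (-Real.pi * ∑ i, (b i).re * (P.mulVec x i) ^ 2) := by
  rw [gaussian, Complex.norm_exp]
  congr 1
  rw [← ofReal_neg, re_ofReal_mul, re_sum]
  congr 1
  refine Finset.sum_congr rfl fun i _ => ?_
  rw [← ofReal_pow, re_mul_ofReal]

theorem exists_norm_gaussian_le {ι : Type*} [Fintype ι] [DecidableEq ι] {P : Matrix ι ι ℝ}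
    (hP : P.det ≠ 0) {b : ι → ℂ} (hb : ∀ i, 0 < (b i).re) :
    ∃ a > 0, ∀ x, ‖gaussian P b x‖ ≤ Real.exp (-a * ∑ i, x i ^ 2) := by
  obtain ⟨δ, hδ, h⟩ := exists_mul_sum_sq_le hP hb
  refine ⟨Real.pi * δ, by positivity, fun x => ?_⟩
  rw [norm_gaussian, Real.exp_le_exp]
  nlinarith [mul_le_mul_of_nonneg_left (h x) Real.pi_pos.le]

theorem summable_gaussian {ι : Type*} [Fintype ι] [DecidableEq ι] {P : Matrix ι ι ℝ}
    (hP : P.det ≠ 0) {b : ι → ℂ} (hb : ∀ i, 0 < (b i).re) :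
    Summable fun v : ι → ℤ => gaussian P b (intVec v) := by
  obtain ⟨a, ha, h⟩ := exists_norm_gaussian_le hP hb
  exact Summable.of_norm_bounded (summable_exp_neg_mul_sum_sq ha) fun v => h _

theorem exists_gaussian_translate_bound {ι : Type*} [Fintype ι] [DecidableEq ι] {P : Matrix ι ι ℝ}
    (hP : P.det ≠ 0) {b : ι → ℂ} (hb : ∀ i, 0 < (b i).re) (R : ℝ) :
    ∃ u : (ι → ℤ) → ℝ, Summable u ∧ ∀ x, ‖x‖ ≤ R → ∀ v, ‖gaussian P b (x + intVec v)‖ ≤ u v := by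
  obtain ⟨a, ha, h⟩ := exists_norm_gaussian_le hP hb
  refine ⟨fun v => Real.exp (a * (Fintype.card ι * R ^ 2)) *
    Real.exp (-(a / 2) * ∑ i, (v i : ℝ) ^ 2),
    (summable_exp_neg_mul_sum_sq (half_pos ha)).mul_left _, fun x hx v => (h _).trans ?_⟩
  simp only [← Real.exp_add, Real.exp_le_exp]
  have h1 : ∑ i, ((v i : ℝ) ^ 2 / 2 - R ^ 2) ≤ ∑ i, (x + intVec v) i ^ 2 := by
    refine Finset.sum_le_sum fun i _ => ?_
    have h2 : |x i| ≤ R := (norm_le_pi_norm x i).trans hx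
    have h3 : x i ^ 2 ≤ R ^ 2 := sq_le_sq' (abs_le.mp h2).1 (abs_le.mp h2).2
    simp only [Pi.add_apply, intVec]
    -- This is `(x + v)² - v²/2 + x² = (2x + v)²/2 ≥ 0`, which costs half of the decay rate in `v`.
    nlinarith [sq_nonneg (2 * x i + v i)]
  rw [Finset.sum_sub_distrib, ← Finset.sum_div, Finset.sum_const, Finset.card_univ,
    nsmul_eq_mul] at h1
  nlinarith [mul_le_mul_of_nonneg_left h1 ha.le]

theorem integral_comp_mulVec {ι : Type*} [Fintype ι] [DecidableEq ι] {P : Matrix ι ι ℝ}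
    (hP : P.det ≠ 0) (h : (ι → ℝ) → ℂ) :
    ∫ x, h (P.mulVec x) = ((|P.det|⁻¹ : ℝ) : ℂ) * ∫ y, h y := by
  have hm := Real.map_matrix_volume_pi_eq_smul_volume_pi hP
  have he : MeasurableEmbedding (Matrix.toLin' P) :=
    (LinearEquiv.ofIsUnitDet (f := Matrix.toLin' P) (v := Pi.basisFun ℝ ι) (v' := Pi.basisFun ℝ ι)
      (by
        rw [← LinearMap.toMatrix'_toLin' P] at hP
        simpa using hP)).toContinuousLinearEquiv.toHomeomorph.measurableEmbedding
  have h1 := he.integral_map (μ := volume) h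
  rw [hm, integral_smul_measure, ENNReal.toReal_ofReal (abs_nonneg _), abs_inv] at h1
  simpa [Matrix.toLin'_apply] using h1.symm

/-- Substituting `y = Px` costs `|det P|⁻¹`, moves the frequency to `p = ᵗP⁻¹w`, and separates the
integral into one-variable Gaussians. -/
theorem fourier_gaussian {ι : Type*} [Fintype ι] [DecidableEq ι] {P : Matrix ι ι ℝ}
    (hP : P.det ≠ 0) {b : ι → ℂ} (hb : ∀ i, 0 < (b i).re) (w : ι → ℤ) :
    ∫ x : ι → ℝ, cexp (2 * Real.pi * I * ∑ i, ((-w) i : ℂ) * x i) * gaussian P b x =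
      ((|P.det|⁻¹ : ℝ) * ∏ i, ((b i)⁻¹) ^ (1 / 2 : ℂ)) *
        gaussian P⁻¹.transpose (fun i => (b i)⁻¹) (intVec w) := by
  set p : ι → ℝ := P⁻¹.transpose.mulVec (intVec w) with hp
  have hb0 : ∀ i, b i ≠ 0 := fun i h => by simpa [h] using hb i
  have hπ : (Real.pi : ℂ) ≠ 0 := by exact_mod_cast Real.pi_ne_zero
  have h1 : ∀ x : ι → ℝ, cexp (2 * Real.pi * I * ∑ i, ((-w) i : ℂ) * x i) * gaussian P b x =
      (fun y : ι → ℝ => cexp (-∑ i, (Real.pi * b i) * (y i : ℂ) ^ 2 +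
        ∑ i, (-(2 * Real.pi * I * p i)) * y i)) (P.mulVec x) := by
    intro x
    have h2 : ∑ i, (w i : ℝ) * x i = ∑ i, p i * (P.mulVec x) i := by
      change intVec w ⬝ᵥ x = p ⬝ᵥ P.mulVec x
      rw [hp, Matrix.mulVec_transpose, ← Matrix.dotProduct_mulVec, Matrix.mulVec_mulVec,
        Matrix.nonsing_inv_mul _ (isUnit_iff_ne_zero.mpr hP), Matrix.one_mulVec]
    have h3 := congrArg (ofReal) h2
    push_cast at h3
    rw [gaussian, ← Complex.exp_add, add_comm]
    simp only [Pi.neg_apply, Int.cast_neg, neg_mul, Finset.sum_neg_distrib, h3, Finset.mul_sum,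
      mul_assoc, mul_neg]
  simp_rw [h1]
  rw [integral_comp_mulVec hP (fun y : ι → ℝ => cexp (-∑ i, (Real.pi * b i) * (y i : ℂ) ^ 2 +
        ∑ i, (-(2 * Real.pi * I * p i)) * y i)),
    GaussianFourier.integral_cexp_neg_sum_mul_add
      (fun i => by rw [re_ofReal_mul]; exact mul_pos Real.pi_pos (hb i)), mul_assoc ((|P.det|⁻¹ : ℝ) : ℂ),
    Finset.prod_mul_distrib, gaussian, Finset.mul_sum, Complex.exp_sum]
  congr 2
  · refine Finset.prod_congr rfl fun i _ => ?_
    congr 1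
    have := hb0 i
    field_simp
  · refine Finset.prod_congr rfl fun i _ => ?_
    congr 1
    have := hb0 i
    rw [← hp]
    field_simp
    rw [I_sq]
    ring

/-- Poisson summation for Gaussians. -/
theorem tsum_gaussian_poisson {ι : Type*} [Fintype ι] [DecidableEq ι] {P : Matrix ι ι ℝ}
    (hP : P.det ≠ 0) {b : ι → ℂ} (hb : ∀ i, 0 < (b i).re) (V : ι → ℝ) :
    ∑' v : ι → ℤ, gaussian P b (V + intVec v) =
      ((|P.det|⁻¹ : ℝ) * ∏ i, ((b i)⁻¹) ^ (1 / 2 : ℂ)) *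
        ∑' w : ι → ℤ, gaussian P⁻¹.transpose (fun i => (b i)⁻¹) (intVec w) *
          cexp (2 * Real.pi * I * ∑ i, (w i : ℂ) * V i) := by
  have hP' : P⁻¹.transpose.det ≠ 0 := by
    rw [Matrix.det_transpose, Matrix.det_nonsing_inv]
    simpa using hP
  have hb' : ∀ i, 0 < ((b i)⁻¹).re := fun i => by
    have h0 : b i ≠ 0 := fun h => by simpa [h] using hb i
    rw [Complex.inv_re]
    exact div_pos (hb i) (Complex.normSq_pos.mpr h0)
  have h := hasSum_poisson (continuous_gaussian P b) (exists_gaussian_translate_bound hP hb)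
    (by simp_rw [fourier_gaussian hP hb]; exact (summable_gaussian hP' hb').mul_left _) V
  simp_rw [fourier_gaussian hP hb] at h
  rw [← h.tsum_eq, ← tsum_mul_left]
  exact tsum_congr fun w => by ring

/-! ### Real congruences and the Siegel upper half-space. -/

open Matrix

open scoped Kronecker

theorem exists_orthogonal_diagonalization {n : ℕ} {X : Matrix (Fin n) (Fin n) ℝ} (hX : X.IsSymm) :
    ∃ (O : Matrix (Fin n) (Fin n) ℝ) (d : Fin n → ℝ), Oᵀ * O = 1 ∧ X = Oᵀ * diagonal d * O := by
  have hX' : X.IsHermitian := by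
    rw [Matrix.IsHermitian, conjTranspose_eq_transpose_of_trivial]
    exact hX
  let U : Matrix (Fin n) (Fin n) ℝ := hX'.eigenvectorUnitary
  have hU : U * Uᵀ = 1 := by
    have := (Matrix.mem_unitaryGroup_iff).mp hX'.eigenvectorUnitary.2
    rwa [star_eq_conjTranspose, conjTranspose_eq_transpose_of_trivial] at this
  refine ⟨Uᵀ, hX'.eigenvalues, by rwa [transpose_transpose], ?_⟩
  have h := hX'.spectral_theorem
  rw [Unitary.conjStarAlgAut_apply, star_eq_conjTranspose,
    conjTranspose_eq_transpose_of_trivial] at h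
  rw [transpose_transpose]
  exact h

theorem exists_transpose_mul_self {n : ℕ} {S : Matrix (Fin n) (Fin n) ℝ} (hS : S.PosDef) :
    ∃ R : Matrix (Fin n) (Fin n) ℝ, R.det ≠ 0 ∧ S = Rᵀ * R := by
  have hsymm : S.IsSymm := by
    have := hS.isHermitian
    rwa [Matrix.IsHermitian, conjTranspose_eq_transpose_of_trivial] at this
  obtain ⟨O, d, hO, rfl⟩ := exists_orthogonal_diagonalization hsymm
  have hO' : O * Oᵀ = 1 := mul_eq_one_comm.mp hO
  have hd : ∀ i, 0 ≤ d i := by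
    have h := hS.posSemidef.mul_mul_conjTranspose_same O
    rw [conjTranspose_eq_transpose_of_trivial, mul_assoc, mul_assoc (Oᵀ * _), hO', mul_one,
      ← mul_assoc, hO', one_mul] at h
    exact posSemidef_diagonal_iff.mp h
  have hR : Oᵀ * diagonal d * O =
      (diagonal (fun i => √(d i)) * O)ᵀ * (diagonal (fun i => √(d i)) * O) := by
    have h : diagonal d = diagonal (fun i => √(d i)) * diagonal (fun i => √(d i)) := by
      rw [diagonal_mul_diagonal]
      congr
      funext i
      exact (Real.mul_self_sqrt (hd i)).symm
    rw [transpose_mul, diagonal_transpose, h]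
    simp only [mul_assoc]
  refine ⟨diagonal (fun i => √(d i)) * O, fun h => ?_, hR⟩
  have := hS.det_pos
  rw [hR, det_mul, h, mul_zero] at this
  exact lt_irrefl _ this

/-- A real matrix viewed as a complex matrix. -/
abbrev toComplex {m n : Type*} (A : Matrix m n ℝ) : Matrix m n ℂ := A.map ofReal

theorem toComplex_mul {l m n : Type*} [Fintype m] (A : Matrix l m ℝ) (B : Matrix m n ℝ) :
    toComplex (A * B) = toComplex A * toComplex B :=
  Matrix.map_mul (f := ofRealHom)

theorem toComplex_transpose {m n : Type*} (A : Matrix m n ℝ) :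
    toComplex Aᵀ = (toComplex A)ᵀ := rfl

theorem det_toComplex {n : Type*} [Fintype n] [DecidableEq n] (A : Matrix n n ℝ) :
    (toComplex A).det = (A.det : ℂ) := (RingHom.map_det ofRealHom A).symm

theorem toComplex_inv {n : Type*} [Fintype n] [DecidableEq n] {A : Matrix n n ℝ}
    (hA : A.det ≠ 0) : toComplex A⁻¹ = (toComplex A)⁻¹ := by
  symm
  refine inv_eq_left_inv ?_
  rw [← toComplex_mul, nonsing_inv_mul _ (isUnit_iff_ne_zero.mpr hA)]
  ext i j
  simp [Matrix.one_apply, apply_ite]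

/-- Points of the Siegel upper half-space are congruent over `ℝ` to diagonal ones. -/
theorem exists_diagonalization {n : ℕ} {σ : Matrix (Fin n) (Fin n) ℂ}
    (hσ : σ ∈ siegelUpperHalfSpace n) :
    ∃ (P : Matrix (Fin n) (Fin n) ℝ) (D : Fin n → ℂ), P.det ≠ 0 ∧ (∀ j, 0 < (D j).im) ∧
      σ = (toComplex P)ᵀ * diagonal D * toComplex P := by
  obtain ⟨R, hR, hY⟩ := exists_transpose_mul_self hσ.2
  have hRu := isUnit_iff_ne_zero.mpr hR
  -- With `Im σ = ᵗRR`, the congruence by `R⁻¹` makes the imaginary part the identity. An orthogonal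
  -- `O` then diagonalizes the real part without disturbing it, so `P = OR` and `D j = d j + i`.
  have hXs : (R⁻¹ᵀ * σ.map re * R⁻¹).IsSymm := by
    have : (σ.map re)ᵀ = σ.map re := by rw [← transpose_map, hσ.1]
    rw [IsSymm, transpose_mul, transpose_mul, transpose_transpose, this, mul_assoc]
  obtain ⟨O, d, hO, hX⟩ := exists_orthogonal_diagonalization hXs
  have hX2 : σ.map re = (O * R)ᵀ * diagonal d * (O * R) := by
    have h1 : Rᵀ * R⁻¹ᵀ = 1 := by rw [← transpose_mul, nonsing_inv_mul _ hRu, transpose_one]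
    calc σ.map re = (Rᵀ * R⁻¹ᵀ) * σ.map re * (R⁻¹ * R) := by
          rw [h1, nonsing_inv_mul _ hRu, one_mul, mul_one]
      _ = Rᵀ * (R⁻¹ᵀ * σ.map re * R⁻¹) * R := by simp only [mul_assoc]
      _ = _ := by rw [hX, transpose_mul]; simp only [mul_assoc]
  have hY2 : σ.map im = (O * R)ᵀ * (O * R) := by
    rw [hY, transpose_mul, ← mul_assoc, mul_assoc Rᵀ, hO, mul_one]
  refine ⟨O * R, fun j => d j + I, ?_, by simp, ?_⟩
  · rw [det_mul]
    refine mul_ne_zero (fun h => ?_) hR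
    have := congrArg det hO
    rw [det_mul, h, mul_zero, det_one] at this
    exact zero_ne_one this
  · have h1 : σ = toComplex (σ.map re) + I • toComplex (σ.map im) := by
      ext i j
      simp [mul_comm I, re_add_im]
    have h2 : diagonal (fun j => (d j : ℂ) + I) = toComplex (diagonal d) + I • 1 := by
      ext i j
      by_cases h : i = j <;> simp [h]
    rw [h1, hX2, hY2, h2]
    simp only [toComplex_mul, toComplex_transpose, mul_add, add_mul, Matrix.mul_smul,
      Matrix.smul_mul, mul_one]

theorem det_ne_zero_of_mem_siegelUpperHalfSpace {n : ℕ} {σ : Matrix (Fin n) (Fin n) ℂ}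
    (hσ : σ ∈ siegelUpperHalfSpace n) : σ.det ≠ 0 := by
  obtain ⟨P, D, hP, hD, rfl⟩ := exists_diagonalization hσ
  rw [det_mul, det_mul, det_transpose, det_toComplex, det_diagonal]
  have : ∏ j, D j ≠ 0 := Finset.prod_ne_zero_iff.mpr fun j _ h => by simpa [h] using hD j
  have h2 : (P.det : ℂ) ≠ 0 := by exact_mod_cast hP
  exact mul_ne_zero (mul_ne_zero h2 this) h2

theorem neg_inv_diagonalization {n : ℕ} {P : Matrix (Fin n) (Fin n) ℝ} {D : Fin n → ℂ}
    (hP : P.det ≠ 0) (hD : ∀ j, 0 < (D j).im) :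
    -((toComplex P)ᵀ * diagonal D * toComplex P)⁻¹ =
      (toComplex P⁻¹ᵀ)ᵀ * diagonal (fun j => -(D j)⁻¹) * toComplex P⁻¹ᵀ := by
  have hD0 : ∀ j, D j ≠ 0 := fun j h => by simpa [h] using hD j
  have hdiag : (diagonal D)⁻¹ = diagonal fun j => (D j)⁻¹ := by
    refine inv_eq_left_inv ?_
    rw [diagonal_mul_diagonal, ← diagonal_one]
    congr
    funext j
    exact inv_mul_cancel₀ (hD0 j)
  rw [Matrix.mul_inv_rev, Matrix.mul_inv_rev, hdiag, toComplex_transpose, toComplex_inv hP, transpose_transpose,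
    ← transpose_nonsing_inv, mul_assoc, ← mul_neg, ← neg_mul]
  congr
  exact (diagonal_neg _).trans rfl

theorem neg_inv_mem_siegelUpperHalfSpace {n : ℕ} {σ : Matrix (Fin n) (Fin n) ℂ}
    (hσ : σ ∈ siegelUpperHalfSpace n) : -σ⁻¹ ∈ siegelUpperHalfSpace n := by
  refine ⟨?_, ?_⟩
  · rw [IsSymm, transpose_neg, transpose_nonsing_inv, hσ.1]
  obtain ⟨P, D, hP, hD, rfl⟩ := exists_diagonalization hσ
  rw [neg_inv_diagonalization hP hD]
  set P' := P⁻¹ᵀ with hP'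
  -- `P'` is real, so taking imaginary parts commutes with the congruence and only the signs of
  -- `Im(-1/D j)` matter.
  have h : ((toComplex P')ᵀ * diagonal (fun j => -(D j)⁻¹) * toComplex P').map im =
      P'ᴴ * diagonal (fun j => (-(D j)⁻¹).im) * P' := by
    ext i j
    rw [map_apply, Matrix.mul_apply, Matrix.mul_apply, im_sum]
    refine Finset.sum_congr rfl fun x _ => ?_
    rw [mul_diagonal, mul_diagonal]
    change (((P' x i : ℝ) : ℂ) * -(D x)⁻¹ * (P' x j : ℝ)).im = P' x i * (-(D x)⁻¹).im * P' x j
    rw [im_mul_ofReal, im_ofReal_mul]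
  rw [h]
  have hdet : P'.det ≠ 0 := by
    rw [hP', det_transpose, det_nonsing_inv]
    simpa using hP
  refine PosDef.conjTranspose_mul_mul_same (PosDef.diagonal fun j => ?_)
    (mulVec_injective_of_isUnit ((isUnit_iff_isUnit_det _).mpr (isUnit_iff_ne_zero.mpr hdet)))
  have h0 : D j ≠ 0 := fun h => by simpa [h] using hD j
  rw [neg_im, inv_im, neg_div, neg_neg]
  exact div_pos (hD j) (normSq_pos.mpr h0)

/-! ### The inversion formula. -/

/-- With `T = R U ᵗP` the trace is `∑ D j (T a j)²`, and `vec T = (P ⊗ R) vec U`. The coefficient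
`-iD j` has positive real part exactly when `D j` has positive imaginary part. -/
theorem expTrace_eq_gaussian {m n : ℕ} (R : Matrix (Fin m) (Fin m) ℝ)
    (P : Matrix (Fin n) (Fin n) ℝ) (D : Fin n → ℂ) (U : Matrix (Fin m) (Fin n) ℝ) :
    expTrace (toComplex (quadVal (Rᵀ * R) U) * ((toComplex P)ᵀ * diagonal D * toComplex P)) =
      gaussian (P ⊗ₖ R) (fun p => -I * D p.1) (vec U) := by
  set T := R * U * Pᵀ with hT
  have h1 : (toComplex (quadVal (Rᵀ * R) U) *
      ((toComplex P)ᵀ * diagonal D * toComplex P)).trace =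
      ((toComplex T)ᵀ * toComplex T * diagonal D).trace := by
    rw [← mul_assoc, trace_mul_comm, hT]
    simp only [quadVal, toComplex_mul, transpose_mul, toComplex_transpose, transpose_transpose,
      Matrix.mul_assoc]
  rw [expTrace, gaussian, kronecker_mulVec_vec, h1]
  congr 1
  rw [trace, Fintype.sum_prod_type, Finset.mul_sum, Finset.mul_sum, ← hT]
  refine Finset.sum_congr rfl fun j _ => ?_
  rw [diag_apply, mul_diagonal, Matrix.mul_apply, Finset.sum_mul, Finset.mul_sum, Finset.mul_sum]
  refine Finset.sum_congr rfl fun a _ => ?_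
  simp only [transpose_apply, map_apply, vec]
  ring

/-- An integral matrix viewed as a real matrix. -/
abbrev toReal {m n : Type*} (A : Matrix m n ℤ) : Matrix m n ℝ := A.map Int.cast

/-- Vectorization of matrices as an equivalence. -/
def vecEquiv (m n R : Type*) : Matrix m n R ≃ (n × m → R) :=
  Equiv.ofBijective vec vec_bijective

theorem det_kronecker_ne_zero {m n : ℕ} {P : Matrix (Fin n) (Fin n) ℝ}
    {R : Matrix (Fin m) (Fin m) ℝ} (hP : P.det ≠ 0) (hR : R.det ≠ 0) : (P ⊗ₖ R).det ≠ 0 := by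
  rw [det_kronecker]
  exact mul_ne_zero (pow_ne_zero _ hP) (pow_ne_zero _ hR)

theorem summable_expTrace_quadVal {m n : ℕ} {S : Matrix (Fin m) (Fin m) ℝ} (hS : S.PosDef)
    {σ : Matrix (Fin n) (Fin n) ℂ} (hσ : σ ∈ siegelUpperHalfSpace n) :
    Summable fun W : Matrix (Fin m) (Fin n) ℤ =>
      expTrace (toComplex (quadVal S (toReal W)) * σ) := by
  obtain ⟨R, hR, rfl⟩ := exists_transpose_mul_self hS
  obtain ⟨P, D, hP, hD, rfl⟩ := exists_diagonalization hσ
  simp_rw [expTrace_eq_gaussian]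
  exact (vecEquiv (Fin m) (Fin n) ℤ).summable_iff.mpr
    (summable_gaussian (det_kronecker_ne_zero hP hR) (b := fun p => -I * D p.1)
      fun p => by simpa using hD p.1)

/-- In rank `2k` each square root occurs `2k` times, so the product is an honest `k`-th power: no
branch survives, and the sign of `det P` disappears as well. -/
theorem gaussian_factor_eq {k n : ℕ} {P : Matrix (Fin n) (Fin n) ℝ} {D : Fin n → ℂ}
    (R : Matrix (Fin (2 * k)) (Fin (2 * k)) ℝ) :
    ((|(P ⊗ₖ R).det|⁻¹ : ℝ) : ℂ) * ∏ p : Fin n × Fin (2 * k), ((-I * D p.1)⁻¹) ^ (1 / 2 : ℂ) =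
      ((√(Rᵀ * R).det ^ n : ℝ) : ℂ)⁻¹ *
        ((-I • ((toComplex P)ᵀ * diagonal D * toComplex P)).det ^ k)⁻¹ := by
  have h1 : √(Rᵀ * R).det = |R.det| := by
    rw [det_mul, det_transpose, Real.sqrt_mul_self_eq_abs]
  have h2 : (-I • ((toComplex P)ᵀ * diagonal D * toComplex P)).det =
      (P.det : ℂ) ^ 2 * ∏ j, (-I * D j) := by
    rw [← Matrix.smul_mul, ← Matrix.mul_smul, det_mul, det_mul, det_transpose, det_toComplex,
      ← diagonal_smul, det_diagonal]
    simp only [Pi.smul_apply, smul_eq_mul]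
    ring
  have h3 : ∏ p : Fin n × Fin (2 * k), ((-I * D p.1)⁻¹) ^ (1 / 2 : ℂ) =
      (∏ j, (-I * D j)⁻¹) ^ k := by
    rw [Fintype.prod_prod_type, ← Finset.prod_pow]
    refine Finset.prod_congr rfl fun j _ => ?_
    simp only [Finset.prod_const, Finset.card_univ, Fintype.card_fin]
    rw [pow_mul, ← Complex.cpow_nat_mul]
    norm_num
  have h4 : |P.det| ^ (2 * k) = (P.det ^ 2) ^ k := by rw [pow_mul, sq_abs]
  rw [h1, h2, h3, det_kronecker, Fintype.card_fin, Fintype.card_fin, abs_mul, abs_pow, abs_pow, h4,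
    Finset.prod_inv_distrib]
  push_cast
  rw [mul_pow, mul_inv, mul_inv, inv_pow]
  ring

/-- The inversion formula for theta series with translations, in even rank. -/
theorem tsum_expTrace_inversion {k n : ℕ} {S : Matrix (Fin (2 * k)) (Fin (2 * k)) ℝ}
    (hS : S.PosDef) {σ : Matrix (Fin n) (Fin n) ℂ} (hσ : σ ∈ siegelUpperHalfSpace n)
    (V : Matrix (Fin (2 * k)) (Fin n) ℝ) :
    ∑' W : Matrix (Fin (2 * k)) (Fin n) ℤ, expTrace (toComplex (quadVal S (V + toReal W)) * σ) =
      ((√S.det ^ n : ℝ) : ℂ)⁻¹ * ((-I • σ).det ^ k)⁻¹ *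
        ∑' U : Matrix (Fin (2 * k)) (Fin n) ℤ,
          expTrace (toComplex (quadVal S⁻¹ (toReal U)) * -σ⁻¹) *
            cexp (2 * Real.pi * I * (((toReal U)ᵀ * V).trace : ℝ)) := by
  obtain ⟨R, hR, rfl⟩ := exists_transpose_mul_self hS
  obtain ⟨P, D, hP, hD, rfl⟩ := exists_diagonalization hσ
  rw [neg_inv_diagonalization hP hD, ← gaussian_factor_eq]
  have hS' : (Rᵀ * R)⁻¹ = R⁻¹ᵀᵀ * R⁻¹ᵀ := by
    rw [Matrix.mul_inv_rev, transpose_transpose, transpose_nonsing_inv]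
  rw [hS']
  simp_rw [expTrace_eq_gaussian]
  have h := tsum_gaussian_poisson (det_kronecker_ne_zero hP hR) (b := fun p => -I * D p.1)
    (fun p => by simpa using hD p.1) (vec V)
  rw [← (vecEquiv (Fin (2 * k)) (Fin n) ℤ).tsum_eq, ← (vecEquiv (Fin (2 * k)) (Fin n) ℤ).tsum_eq]
    at h
  refine Eq.trans (Eq.trans (tsum_congr fun W => rfl) h) ?_
  congr 1
  refine tsum_congr fun U => ?_
  have h1 : (P ⊗ₖ R)⁻¹ᵀ = P⁻¹ᵀ ⊗ₖ R⁻¹ᵀ := by rw [inv_kronecker, kroneckerMap_transpose]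
  have h2 : (fun p : Fin n × Fin (2 * k) => (-I * D p.1)⁻¹) = fun p => -I * -(D p.1)⁻¹ := by
    funext p
    rw [mul_inv, inv_neg, inv_I]
    ring
  have h3 : ∑ p : Fin n × Fin (2 * k), ((vecEquiv (Fin (2 * k)) (Fin n) ℤ U p : ℤ) : ℂ) *
      (vec V p : ℝ) = (((toReal U)ᵀ * V).trace : ℝ) := by
    rw [← vec_dotProduct_vec]
    simp only [dotProduct]
    push_cast
    rfl
  rw [h1, h2, h3]
  rfl

/-! ### Real positivity and the limit at `i∞`. -/

theorem toReal_mulVec_dotProduct {m : ℕ} (Q : Matrix (Fin m) (Fin m) ℤ) (x : Fin m → ℤ) :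
    intVec x ⬝ᵥ (toReal Q).mulVec (intVec x) = ((x ⬝ᵥ Q.mulVec x : ℤ) : ℝ) := by
  simp only [dotProduct, mulVec, intVec, map_apply]
  push_cast
  rfl

theorem det_toReal {m : ℕ} (Q : Matrix (Fin m) (Fin m) ℤ) : (toReal Q).det = (Q.det : ℝ) :=
  (RingHom.map_det (Int.castRingHom ℝ) Q).symm

theorem IsPositiveDefinite.det_ne_zero {m : ℕ} {Q : Matrix (Fin m) (Fin m) ℤ}
    (hpos : IsPositiveDefinite Q) : Q.det ≠ 0 := by
  intro h
  obtain ⟨v, hv, hQv⟩ := Matrix.exists_mulVec_eq_zero_iff.mpr h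
  have := hpos v hv
  simp [hQv] at this

/-- Clearing denominators gives nonnegativity on `ℚ^m`, and density extends it to `ℝ^m`. Strictness
does not pass to the limit; it is recovered from `det Q ≠ 0`. -/
theorem IsPositiveDefinite.posDef_toReal {m : ℕ} {Q : Matrix (Fin m) (Fin m) ℤ}
    (hpos : IsPositiveDefinite Q) (hQ : Q.IsSymm) : (toReal Q).PosDef := by
  have hherm : (toReal Q).IsHermitian := by
    rw [IsHermitian, conjTranspose_eq_transpose_of_trivial, ← transpose_map, hQ]
  have hpsd : (toReal Q).PosSemidef := by
    refine PosSemidef.of_dotProduct_mulVec_nonneg hherm fun x => ?_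
    rw [star_trivial]
    have hdense : DenseRange (Pi.map fun (_ : Fin m) (q : ℚ) => (q : ℝ)) :=
      DenseRange.piMap fun _ => Rat.isDenseEmbedding_coe_real.dense
    refine isClosed_property hdense (p := fun x => 0 ≤ x ⬝ᵥ (toReal Q).mulVec x) ?_
      (fun q => ?_) x
    · exact isClosed_le continuous_const (by fun_prop)
    · obtain ⟨b, hb⟩ := IsLocalization.exist_integer_multiples_of_finite (nonZeroDivisors ℤ) q
      choose z hz using hb
      have hb0 : ((b : ℤ) : ℝ) ≠ 0 := by exact_mod_cast nonZeroDivisors.ne_zero b.2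
      have hq : Pi.map (fun (_ : Fin m) (q : ℚ) => (q : ℝ)) q = ((b : ℤ) : ℝ)⁻¹ • intVec z := by
        funext i
        have h := congrArg (Rat.cast : ℚ → ℝ) (hz i)
        simp only [Pi.map_apply, Pi.smul_apply, intVec, smul_eq_mul]
        rw [eq_inv_mul_iff_mul_eq₀ hb0]
        simpa using h.symm
      rw [hq, mulVec_smul, dotProduct_smul, smul_dotProduct, toReal_mulVec_dotProduct, smul_eq_mul,
        smul_eq_mul, ← mul_assoc]
      refine mul_nonneg (mul_self_nonneg _) ?_
      rcases eq_or_ne z 0 with rfl | h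
      · simp
      · exact_mod_cast (hpos z h).le
  refine hpsd.posDef_iff_isUnit.mpr ((isUnit_iff_isUnit_det _).mpr (isUnit_iff_ne_zero.mpr ?_))
  rw [det_toReal]
  exact_mod_cast hpos.det_ne_zero

theorem norm_expTrace_toComplex_mul {n : ℕ} (A : Matrix (Fin n) (Fin n) ℝ)
    (τ : Matrix (Fin n) (Fin n) ℂ) :
    ‖expTrace (toComplex A * τ)‖ = Real.exp (-Real.pi * (A * τ.map im).trace) := by
  rw [expTrace, Complex.norm_exp]
  have h : (toComplex A * τ).trace.im = (A * τ.map im).trace := by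
    simp only [trace, diag_apply, Matrix.mul_apply, im_sum, map_apply, im_ofReal_mul]
  rw [mul_assoc, re_ofReal_mul, I_mul_re, h]
  congr 1
  ring

/-- By cyclicity, `Tr(ᵗC C A) = Tr(C A ᵗC)`. -/
theorem trace_mul_nonneg {n : ℕ} {A B : Matrix (Fin n) (Fin n) ℝ} (hA : A.PosSemidef)
    {m : ℕ} {C : Matrix (Fin m) (Fin n) ℝ} (hB : B = Cᵀ * C) : 0 ≤ (B * A).trace := by
  rw [hB, Matrix.mul_assoc, trace_mul_comm]
  have := (hA.mul_mul_conjTranspose_same C).trace_nonneg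
  rwa [conjTranspose_eq_transpose_of_trivial] at this

theorem quadVal_transpose_mul_self {m n : ℕ} (R : Matrix (Fin m) (Fin m) ℝ)
    (U : Matrix (Fin m) (Fin n) ℝ) : quadVal (Rᵀ * R) U = (R * U)ᵀ * (R * U) := by
  simp only [quadVal, transpose_mul, Matrix.mul_assoc]

theorem norm_expTrace_quadVal_le {m n : ℕ} {S : Matrix (Fin m) (Fin m) ℝ} (hS : S.PosDef)
    (U : Matrix (Fin m) (Fin n) ℝ) {τ : Matrix (Fin n) (Fin n) ℂ} {c : ℝ}
    (hc : (τ.map im - c • (1 : Matrix (Fin n) (Fin n) ℝ)).PosSemidef) :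
    ‖expTrace (toComplex (quadVal S U) * τ)‖ ≤ Real.exp (-Real.pi * (c * (quadVal S U).trace)) := by
  obtain ⟨R, hR, rfl⟩ := exists_transpose_mul_self hS
  rw [norm_expTrace_toComplex_mul, Real.exp_le_exp]
  have h := trace_mul_nonneg hc (quadVal_transpose_mul_self R U)
  rw [mul_sub, trace_sub, Matrix.mul_smul, mul_one, trace_smul, smul_eq_mul] at h
  nlinarith [Real.pi_pos]

theorem trace_quadVal_pos {m n : ℕ} {S : Matrix (Fin m) (Fin m) ℝ} (hS : S.PosDef)
    {U : Matrix (Fin m) (Fin n) ℝ} (hU : U ≠ 0) : 0 < (quadVal S U).trace := by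
  obtain ⟨R, hR, rfl⟩ := exists_transpose_mul_self hS
  rw [quadVal_transpose_mul_self, ← conjTranspose_eq_transpose_of_trivial]
  refine lt_of_le_of_ne (posSemidef_conjTranspose_mul_self _).trace_nonneg fun h => hU ?_
  have h0 := trace_conjTranspose_mul_self_eq_zero_iff.mp h.symm
  calc U = R⁻¹ * (R * U) := by
        rw [← Matrix.mul_assoc, nonsing_inv_mul _ (isUnit_iff_ne_zero.mpr hR), Matrix.one_mul]
    _ = 0 := by rw [h0, Matrix.mul_zero]

theorem I_smul_one_mem_siegelUpperHalfSpace (n : ℕ) :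
    (I • (1 : Matrix (Fin n) (Fin n) ℂ)) ∈ siegelUpperHalfSpace n := by
  refine ⟨by simp [IsSymm], ?_⟩
  have : (I • (1 : Matrix (Fin n) (Fin n) ℂ)).map im = 1 := by
    ext i j
    by_cases h : i = j <;> simp [h, Matrix.one_apply]
  rw [this]
  exact PosDef.one

/-- This is the absolute theta series at `τ = iI`; it dominates all `τ` with `Im τ ≥ I`. -/
theorem summable_exp_neg_trace_quadVal {m : ℕ} (n : ℕ) {S : Matrix (Fin m) (Fin m) ℝ}
    (hS : S.PosDef) : Summable fun U : Matrix (Fin m) (Fin n) ℤ =>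
      Real.exp (-Real.pi * (1 * (quadVal S (toReal U)).trace)) := by
  refine (summable_expTrace_quadVal hS (I_smul_one_mem_siegelUpperHalfSpace n)).norm.congr
    fun U => ?_
  rw [norm_expTrace_toComplex_mul]
  have : (I • (1 : Matrix (Fin n) (Fin n) ℂ)).map im = 1 := by
    ext i j
    by_cases h : i = j <;> simp [h, Matrix.one_apply]
  rw [this, mul_one, one_mul]

theorem eventually_atIInfty {n : ℕ} (c : ℝ) : ∀ᶠ τ in atIInfty n, τ ∈ siegelUpperHalfSpace n ∧
    (τ.map im - c • (1 : Matrix (Fin n) (Fin n) ℝ)).PosSemidef :=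
  mem_iInf_of_mem c (mem_principal_self _)

/-- Only the term `U = 0` of a twisted theta series survives as `τ → i∞`. -/
theorem tendsto_twisted_theta {m n : ℕ} {S : Matrix (Fin m) (Fin m) ℝ} (hS : S.PosDef)
    {c : Matrix (Fin m) (Fin n) ℤ → ℂ} (hc : ∀ U, ‖c U‖ = 1) (hc0 : c 0 = 1) :
    Tendsto (fun τ => ∑' U : Matrix (Fin m) (Fin n) ℤ,
      expTrace (toComplex (quadVal S (toReal U)) * τ) * c U) (atIInfty n) (𝓝 1) := by
  have h1 : (1 : ℂ) = ∑' U : Matrix (Fin m) (Fin n) ℤ, if U = 0 then 1 else 0 := by simp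
  rw [h1]
  refine tendsto_tsum_of_dominated_convergence (summable_exp_neg_trace_quadVal n hS)
    (fun U => ?_) ?_
  · by_cases hU : U = 0
    · subst hU
      refine tendsto_const_nhds.congr fun τ => ?_
      have : quadVal S (toReal (0 : Matrix (Fin m) (Fin n) ℤ)) = 0 := by
        simp [quadVal, toReal]
      rw [if_pos rfl, this, hc0]
      simp [expTrace, toComplex]
    · rw [if_neg hU]
      have hU' : toReal U ≠ 0 := fun h => hU (Matrix.ext fun i j => by
        have := congrFun (congrFun h i) j
        simpa using this)
      have ht := trace_quadVal_pos hS hU'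
      rw [Metric.tendsto_nhds]
      intro ε hε
      have hlim : Tendsto (fun c : ℝ => Real.exp (-Real.pi * (c * (quadVal S (toReal U)).trace)))
          atTop (𝓝 0) := by
        refine Real.tendsto_exp_atBot.comp ?_
        exact (tendsto_id.atTop_mul_const ht).const_mul_atTop_of_neg (neg_neg_of_pos Real.pi_pos)
      -- A lower bound `c₀` for `Im τ` making this single term smaller than `ε`, whatever `Re τ` is.
      obtain ⟨c₀, hc₀⟩ := (hlim.eventually (gt_mem_nhds hε)).exists
      filter_upwards [eventually_atIInfty c₀] with τ hτ
      rw [dist_zero_right, norm_mul, hc, mul_one]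
      exact (norm_expTrace_quadVal_le hS _ hτ.2).trans_lt hc₀
  · filter_upwards [eventually_atIInfty 1] with τ hτ U
    rw [norm_mul, hc, mul_one]
    exact norm_expTrace_quadVal_le hS _ hτ.2

/-! ### Residue classes and the integral trace form. -/

/-- The representative in `{0, …, d - 1}` of a matrix of residues. -/
abbrev residueRep {m n d : ℕ} (V : Matrix (Fin m) (Fin n) (Fin d)) : Matrix (Fin m) (Fin n) ℤ :=
  V.map fun v => ((v : ℕ) : ℤ)

/-- Division with remainder by `N` for integral matrices. -/
def divModMatrixEquiv (m n N : ℕ) [NeZero N] :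
    Matrix (Fin m) (Fin n) (Fin N) × Matrix (Fin m) (Fin n) ℤ ≃ Matrix (Fin m) (Fin n) ℤ where
  toFun p := residueRep p.1 + (N : ℤ) • p.2
  invFun W := (of fun i j => (Int.divModEquiv N (W i j)).2,
    of fun i j => (Int.divModEquiv N (W i j)).1)
  left_inv p := by
    have h : ∀ i j, Int.divModEquiv N (((p.1 i j : ℕ) : ℤ) + N * p.2 i j) = (p.2 i j, p.1 i j) :=
      fun i j => by
        rw [← Equiv.eq_symm_apply]
        simp [Int.divModEquiv, mul_comm, add_comm]
    ext i j <;> simp [h]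
  right_inv W := by
    ext i j
    have h := (Int.divModEquiv N).symm_apply_apply (W i j)
    simp only [Int.divModEquiv, Equiv.coe_fn_symm_mk, Equiv.coe_fn_mk] at h
    simp only [Int.divModEquiv, Equiv.coe_fn_mk, Matrix.add_apply, map_apply, of_apply,
      Matrix.smul_apply, smul_eq_mul]
    linarith

theorem tsum_eq_sum_residue {m n N : ℕ} [NeZero N] {g : Matrix (Fin m) (Fin n) ℤ → ℂ}
    (hg : Summable g) : ∑' W, g W =
      ∑ V : Matrix (Fin m) (Fin n) (Fin N), ∑' W, g (residueRep V + (N : ℤ) • W) := by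
  rw [← (divModMatrixEquiv m n N).tsum_eq,
    Summable.tsum_prod
    (f := fun p => g (divModMatrixEquiv m n N p)) ((divModMatrixEquiv m n N).summable_iff.mpr hg),
    tsum_fintype]
  rfl

theorem thetaTerm_eq_expTrace {m n : ℕ} (Q : Matrix (Fin m) (Fin m) ℤ) (τ : Matrix (Fin n) (Fin n) ℂ)
    (U : Matrix (Fin m) (Fin n) ℤ) :
    thetaTerm Q τ U = expTrace (toComplex (quadVal (toReal Q) (toReal U)) * τ) := by
  have : toComplex (quadVal (toReal Q) (toReal U)) = (quadVal Q U).map (Int.cast : ℤ → ℂ) := by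
    ext i j
    simp [quadVal, Matrix.mul_apply]
  rw [thetaTerm, this]

theorem quadVal_smul {R : Type*} [CommRing R] {m n : ℕ} (Q : Matrix (Fin m) (Fin m) R) (c : R)
    (U : Matrix (Fin m) (Fin n) R) : quadVal Q (c • U) = c ^ 2 • quadVal Q U := by
  simp only [quadVal, transpose_smul, Matrix.smul_mul, Matrix.mul_smul, smul_smul, sq]

theorem quadVal_smul_left {R : Type*} [CommRing R] {m n : ℕ} (Q : Matrix (Fin m) (Fin m) R) (c : R)
    (U : Matrix (Fin m) (Fin n) R) : quadVal (c • Q) U = c • quadVal Q U := by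
  simp only [quadVal, Matrix.smul_mul, Matrix.mul_smul]

/-- The two cross terms have transposed matrices, hence equal traces up to cyclicity. The resulting
factor 2 is what permits congruences modulo `2N`. -/
theorem trace_quadVal_add {R : Type*} [CommRing R] {m n : ℕ} {A : Matrix (Fin m) (Fin m) R}
    (hA : A.IsSymm) {M : Matrix (Fin n) (Fin n) R} (hM : M.IsSymm)
    (V W : Matrix (Fin m) (Fin n) R) :
    (quadVal A (V + W) * M).trace = (quadVal A V * M).trace + (quadVal A W * M).trace +
      2 * (Vᵀ * A * W * M).trace := by
  have h : (Wᵀ * A * V * M).trace = (Vᵀ * A * W * M).trace := by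
    rw [← trace_transpose]
    simp only [transpose_mul, hA.eq, hM.eq, transpose_transpose]
    rw [trace_mul_comm]
    simp only [Matrix.mul_assoc]
  simp only [quadVal, transpose_add, Matrix.add_mul, Matrix.mul_add, trace_add, h]
  ring

/-- Modulo 2, swapping the indices cancels the off-diagonal terms in pairs, and the diagonal ones
vanish. -/
theorem even_sum_sum_of_symm {ι : Type*} [Fintype ι] {F : ι → ι → ℤ} (hF : ∀ i j, F i j = F j i)
    (hd : ∀ i, Even (F i i)) : Even (∑ i, ∑ j, F i j) := by
  rw [← ZMod.intCast_eq_zero_iff_even, ← Fintype.sum_prod_type', Int.cast_sum]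
  refine Finset.sum_involution (fun p _ => p.swap) (fun p _ => ?_) (fun p _ hp h => hp ?_)
    (fun _ _ => Finset.mem_univ _) fun _ _ => Prod.swap_swap _
  · rw [Prod.fst_swap, Prod.snd_swap, hF p.2 p.1]
    exact CharTwo.add_self_eq_zero _
  · have : p.2 = p.1 := congrArg Prod.fst h
    rw [ZMod.intCast_eq_zero_iff_even, this]
    exact hd _

/-- The integral form `Tr(ᵗV A V M)`. -/
def traceForm {m n : ℕ} (A : Matrix (Fin m) (Fin m) ℤ) (M : Matrix (Fin n) (Fin n) ℤ)
    (V : Matrix (Fin m) (Fin n) ℤ) : ℤ :=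
  (quadVal A V * M).trace

/-- As a quadratic form in the entries of `V` its matrix is `M ⊗ A`, symmetric with even diagonal.
Evenness of `A` suffices; the diagonal of `M` may be odd. -/
theorem even_traceForm {m n : ℕ} {A : Matrix (Fin m) (Fin m) ℤ} (hA : IsEvenIntegral A)
    {M : Matrix (Fin n) (Fin n) ℤ} (hM : M.IsSymm) (V : Matrix (Fin m) (Fin n) ℤ) :
    Even (traceForm A M V) := by
  have h : traceForm A M V = ∑ p : Fin n × Fin m, ∑ p' : Fin n × Fin m,
      V p.2 p.1 * A p.2 p'.2 * V p'.2 p'.1 * M p'.1 p.1 := by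
    simp only [traceForm, quadVal, trace, diag_apply, Matrix.mul_apply, transpose_apply,
      Fintype.sum_prod_type, Finset.sum_mul]
    refine Finset.sum_congr rfl fun j _ => ?_
    symm
    rw [Finset.sum_comm]
    exact Finset.sum_congr rfl fun j' _ => Finset.sum_comm
  rw [h]
  refine even_sum_sum_of_symm (fun p p' => ?_) fun p => ?_
  · rw [hM.apply, hA.1.apply]
    ring
  · exact (((hA.2 p.2).mul_left _).mul_right _).mul_right _

theorem traceForm_add {m n : ℕ} {A : Matrix (Fin m) (Fin m) ℤ} (hA : A.IsSymm)
    {M : Matrix (Fin n) (Fin n) ℤ} (hM : M.IsSymm) (V W : Matrix (Fin m) (Fin n) ℤ) :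
    traceForm A M (V + W) =
      traceForm A M V + traceForm A M W + 2 * (Vᵀ * A * W * M).trace :=
  trace_quadVal_add hA hM V W

theorem traceForm_smul {m n : ℕ} (A : Matrix (Fin m) (Fin m) ℤ)
    (M : Matrix (Fin n) (Fin n) ℤ) (c : ℤ) (V : Matrix (Fin m) (Fin n) ℤ) :
    traceForm A M (c • V) = c ^ 2 * traceForm A M V := by
  rw [traceForm, quadVal_smul, Matrix.smul_mul, trace_smul, smul_eq_mul, traceForm]

/-- The character `exp(π i c² Tr(ᵗV A V M) / N)`. -/
def gaussTerm {m n : ℕ} (A : Matrix (Fin m) (Fin m) ℤ) (M : Matrix (Fin n) (Fin n) ℤ) (N : ℕ)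
    (c : ℕ) (V : Matrix (Fin m) (Fin n) ℤ) : ℂ :=
  cexp (Real.pi * I * ((c : ℂ) ^ 2 * (traceForm A M V : ℂ) / N))

/-- Congruence of the exponents modulo `2N` gives equality of exponentials. -/
theorem cexp_div_eq_of_sub_eq {N : ℕ} (hN : N ≠ 0) {a b c : ℤ} (h : a = b + 2 * N * c) :
    cexp (Real.pi * I * ((a : ℂ) / N)) = cexp (Real.pi * I * ((b : ℂ) / N)) := by
  rw [Complex.exp_eq_exp_iff_exists_int]
  refine ⟨c, ?_⟩
  have : (N : ℂ) ≠ 0 := by exact_mod_cast hN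
  rw [h]
  push_cast
  field_simp

theorem gaussTerm_add_smul {m n : ℕ} {A : Matrix (Fin m) (Fin m) ℤ} (hA : IsEvenIntegral A)
    {M : Matrix (Fin n) (Fin n) ℤ} (hM : M.IsSymm) {N c d : ℕ} (hN : N ≠ 0) (hcd : c * d = N)
    (V W : Matrix (Fin m) (Fin n) ℤ) :
    gaussTerm A M N c (V + (d : ℤ) • W) = gaussTerm A M N c V := by
  obtain ⟨t, ht⟩ := even_traceForm hA hM W
  -- With `cd = N` and `traceForm A M W = 2t`, the shift contributes `c²(2d²t + 2d·X) = 2N(Nt +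
  -- cX)`, where `X` is the mixed trace.
  have h := cexp_div_eq_of_sub_eq hN (a := (c : ℤ) ^ 2 * traceForm A M (V + (d : ℤ) • W))
    (b := (c : ℤ) ^ 2 * traceForm A M V) (c := N * t + c * (Vᵀ * A * W * M).trace) (by
      rw [traceForm_add hA.1 hM, traceForm_smul, ht, Matrix.mul_smul, Matrix.smul_mul,
        trace_smul, smul_eq_mul, ← hcd]
      push_cast
      ring)
  simpa [gaussTerm] using h

theorem gaussTerm_mul_gaussTerm {m n : ℕ} {A : Matrix (Fin m) (Fin m) ℤ} (hA : IsEvenIntegral A)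
    {M : Matrix (Fin n) (Fin n) ℤ} (hM : M.IsSymm) {N c d₁ d₂ : ℕ} (hN : N ≠ 0)
    (h : c * (d₁ * d₂) = N) (V₁ V₂ : Matrix (Fin m) (Fin n) ℤ) :
    gaussTerm A M N c ((d₂ : ℤ) • V₁ + (d₁ : ℤ) • V₂) =
      gaussTerm A M N (c * d₂) V₁ * gaussTerm A M N (c * d₁) V₂ := by
  have h := cexp_div_eq_of_sub_eq hN
    (a := (c : ℤ) ^ 2 * traceForm A M ((d₂ : ℤ) • V₁ + (d₁ : ℤ) • V₂))
    (b := ((c * d₂ : ℕ) : ℤ) ^ 2 * traceForm A M V₁ + ((c * d₁ : ℕ) : ℤ) ^ 2 * traceForm A M V₂)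
    -- The cross term is `2c²d₁d₂X = 2N·cX`, with `X` the mixed trace.
    (c := c * (V₁ᵀ * A * V₂ * M).trace) (by
      rw [traceForm_add hA.1 hM, traceForm_smul, traceForm_smul, Matrix.mul_smul,
        Matrix.smul_mul, trace_smul, transpose_smul, Matrix.smul_mul, Matrix.smul_mul,
        Matrix.smul_mul, trace_smul, smul_eq_mul, smul_eq_mul, ← h]
      push_cast
      ring)
  rw [gaussTerm, gaussTerm, gaussTerm, ← Complex.exp_add]
  push_cast at h ⊢
  rw [h]
  congr 1
  ring

/-! ### Factorization of Gauss sums. -/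

/-- The normalized Gauss sum over matrices modulo `d`. -/
def normalizedGaussSum {m n : ℕ} (A : Matrix (Fin m) (Fin m) ℤ) (M : Matrix (Fin n) (Fin n) ℤ)
    (N d : ℕ) : ℂ :=
  ((d : ℂ) ^ (m * n))⁻¹ * ∑ V : Matrix (Fin m) (Fin n) (Fin d),
    gaussTerm A M N (N / d) (residueRep V)

/-- The Chinese remainder bijection `(x, y) ↦ d₂ x + d₁ y mod d₁ d₂`. -/
theorem exists_crt_equiv {d₁ d₂ : ℕ} (h : d₁.Coprime d₂) :
    ∃ e : Fin d₁ × Fin d₂ ≃ Fin (d₁ * d₂), ∀ p, ∃ t : ℤ,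
      ((d₂ : ℤ) * (p.1 : ℕ) + d₁ * (p.2 : ℕ)) = ((e p : ℕ) : ℤ) + ((d₁ * d₂ : ℕ) : ℤ) * t := by
  let f : Fin d₁ × Fin d₂ → Fin (d₁ * d₂) := fun p =>
    ⟨(d₂ * p.1 + d₁ * p.2) % (d₁ * d₂),
      Nat.mod_lt _ (Nat.mul_pos (Fin.pos p.1) (Fin.pos p.2))⟩
  have hinj : Function.Injective f := by
    rintro ⟨x, y⟩ ⟨x', y'⟩ hxy
    have hmod : d₂ * x + d₁ * y ≡ d₂ * x' + d₁ * y' [MOD d₁ * d₂] := congrArg Fin.val hxy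
    have h1 : d₂ * (x : ℕ) ≡ d₂ * x' [MOD d₁] := by
      have := hmod.of_mul_right d₂
      simpa [Nat.ModEq] using this
    have h2 : d₁ * (y : ℕ) ≡ d₁ * y' [MOD d₂] := by
      have := hmod.of_mul_left d₁
      simpa [Nat.ModEq] using this
    have h3 := Nat.ModEq.cancel_left_of_coprime h h1
    have h4 := Nat.ModEq.cancel_left_of_coprime h.symm h2
    exact Prod.ext (Fin.ext (h3.eq_of_lt_of_lt x.2 x'.2)) (Fin.ext (h4.eq_of_lt_of_lt y.2 y'.2))
  have hbij : Function.Bijective f :=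
    (Fintype.bijective_iff_injective_and_card f).mpr ⟨hinj, by simp⟩
  refine ⟨Equiv.ofBijective f hbij, fun p =>
    ⟨((d₂ * p.1 + d₁ * p.2) / (d₁ * d₂) : ℕ), ?_⟩⟩
  have := Nat.mod_add_div (d₂ * p.1 + d₁ * p.2) (d₁ * d₂)
  exact_mod_cast this.symm

/-- The Chinese remainder bijection is applied entrywise. The scales match because `N/d₁ = c d₂` and
`N/d₂ = c d₁` for `c = N/(d₁d₂)`, and reduction modulo `d₁d₂` does not change the character. -/
theorem normalizedGaussSum_mul {m n : ℕ} {A : Matrix (Fin m) (Fin m) ℤ} (hA : IsEvenIntegral A)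
    {M : Matrix (Fin n) (Fin n) ℤ} (hM : M.IsSymm) {N d₁ d₂ : ℕ} (hN : N ≠ 0)
    (h : d₁.Coprime d₂) (hd : d₁ * d₂ ∣ N) :
    normalizedGaussSum A M N (d₁ * d₂) =
      normalizedGaussSum A M N d₁ * normalizedGaussSum A M N d₂ := by
  obtain ⟨c, hc⟩ := hd
  have hc' : c * (d₁ * d₂) = N := by rw [hc, mul_comm]
  have h0 : d₁ * d₂ ≠ 0 := fun h => hN (by rw [hc, h, zero_mul])
  have h1 : 0 < d₁ := Nat.pos_of_ne_zero fun h => h0 (by simp [h])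
  have h2 : 0 < d₂ := Nat.pos_of_ne_zero fun h => h0 (by simp [h])
  have e0 : N / (d₁ * d₂) = c := by rw [hc]; exact Nat.mul_div_cancel_left _ (Nat.pos_of_ne_zero h0)
  have e1 : N / d₁ = c * d₂ := by
    rw [hc, mul_assoc, Nat.mul_div_cancel_left _ h1, mul_comm]
  have e2 : N / d₂ = c * d₁ := by
    rw [hc, mul_comm d₁, mul_assoc, Nat.mul_div_cancel_left _ h2, mul_comm]
  obtain ⟨e, he⟩ := exists_crt_equiv h
  let E : Matrix (Fin m) (Fin n) (Fin d₁) × Matrix (Fin m) (Fin n) (Fin d₂) ≃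
      Matrix (Fin m) (Fin n) (Fin (d₁ * d₂)) :=
    { toFun := fun p => of fun i j => e (p.1 i j, p.2 i j)
      invFun := fun V => (V.map fun v => (e.symm v).1, V.map fun v => (e.symm v).2)
      left_inv := fun p => by ext <;> simp
      right_inv := fun V => by ext; simp }
  have hsum : ∑ V : Matrix (Fin m) (Fin n) (Fin (d₁ * d₂)), gaussTerm A M N c (residueRep V) =
      (∑ V : Matrix (Fin m) (Fin n) (Fin d₁), gaussTerm A M N (c * d₂) (residueRep V)) *
        ∑ V : Matrix (Fin m) (Fin n) (Fin d₂), gaussTerm A M N (c * d₁) (residueRep V) := by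
    rw [Finset.sum_mul_sum, ← Fintype.sum_prod_type', ← E.sum_comp]
    refine Finset.sum_congr rfl fun p _ => ?_
    rw [← gaussTerm_mul_gaussTerm hA hM hN hc']
    choose t ht using he
    have hp : (d₂ : ℤ) • residueRep p.1 + (d₁ : ℤ) • residueRep p.2 =
        residueRep (E p) + ((d₁ * d₂ : ℕ) : ℤ) • of fun i j => t (p.1 i j, p.2 i j) := by
      ext i j
      exact ht (p.1 i j, p.2 i j)
    rw [hp, gaussTerm_add_smul hA hM hN hc']
  rw [normalizedGaussSum, normalizedGaussSum, normalizedGaussSum, e0, e1, e2, hsum]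
  push_cast
  rw [mul_pow, mul_inv]
  ring

theorem normalizedGaussSum_eq_prod {m n : ℕ} {A : Matrix (Fin m) (Fin m) ℤ}
    (hA : IsEvenIntegral A) {M : Matrix (Fin n) (Fin n) ℤ} (hM : M.IsSymm) {N : ℕ} (hN : N ≠ 0) :
    normalizedGaussSum A M N N =
      ∏ q ∈ N.primeFactors, normalizedGaussSum A M N (q ^ N.factorization q) := by
  -- Induction over sets of primes with `N` fixed in the denominator; only the modulus grows.
  have h : ∀ s ⊆ N.primeFactors, normalizedGaussSum A M N (∏ q ∈ s, q ^ N.factorization q) =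
      ∏ q ∈ s, normalizedGaussSum A M N (q ^ N.factorization q) := by
    intro s
    induction s using Finset.induction_on with
    | empty =>
      intro _
      have hz : ∀ V : Matrix (Fin m) (Fin n) (Fin 1), residueRep V = 0 := fun V => by
        ext i j
        simp
      simp only [Finset.prod_empty, normalizedGaussSum, hz, gaussTerm, traceForm, quadVal]
      simp only [Nat.cast_one, one_pow, inv_one, Matrix.mul_zero, Matrix.zero_mul, trace_zero,
        Int.cast_zero, mul_zero, zero_div, Complex.exp_zero, one_mul, Finset.sum_const,
        nsmul_eq_mul, mul_one, Nat.cast_eq_one]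
      exact Fintype.card_eq_one_iff.mpr ⟨0, fun V => by ext i j; simp⟩
    | insert q s hq ih =>
      intro hs
      have hs' : s ⊆ N.primeFactors := fun x hx => hs (Finset.mem_insert_of_mem hx)
      have hqp := Nat.prime_of_mem_primeFactors (hs (Finset.mem_insert_self q s))
      rw [Finset.prod_insert hq, Finset.prod_insert hq, ← ih hs']
      refine normalizedGaussSum_mul hA hM hN ?_ ?_
      · refine Nat.Coprime.prod_right fun p hp => Nat.Coprime.pow _ _ ?_
        refine (Nat.coprime_primes hqp (Nat.prime_of_mem_primeFactors (hs' hp))).mpr ?_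
        rintro rfl
        exact hq hp
      · rw [← Finset.prod_insert (f := fun q => q ^ N.factorization q) hq]
        conv_rhs => rw [← Nat.prod_factorization_pow_eq_self hN]
        exact Finset.prod_dvd_prod_of_subset _ _ _ hs
  rw [← h _ (Finset.Subset.refl _)]
  congr 1
  exact (Nat.prod_factorization_pow_eq_self hN).symm

/-! ### Passing between `Q⁻¹` and the integral matrix `A = NQ⁻¹`. -/

theorem expTrace_real {n : ℕ} (B : Matrix (Fin n) (Fin n) ℝ) (C : Matrix (Fin n) (Fin n) ℝ) :
    expTrace (toComplex B * toComplex C) = cexp (Real.pi * I * ((B * C).trace : ℝ)) := by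
  rw [expTrace, ← toComplex_mul]
  congr 2
  simp [trace]

theorem expTrace_add {n : ℕ} (B C : Matrix (Fin n) (Fin n) ℂ) :
    expTrace (B + C) = expTrace B * expTrace C := by
  rw [expTrace, trace_add, mul_add, Complex.exp_add]
  rfl

theorem toReal_inv_eq {m N : ℕ} {Q A : Matrix (Fin m) (Fin m) ℤ} (hQ : Q.det ≠ 0)
    (hN : N ≠ 0) (hA : (N : ℚ) • ratInv Q = A.map (Int.cast : ℤ → ℚ)) :
    (toReal Q)⁻¹ = (N : ℝ)⁻¹ • toReal A := by
  have hN' : (N : ℚ) ≠ 0 := by exact_mod_cast hN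
  have hN'' : (N : ℝ) ≠ 0 := by exact_mod_cast hN
  have hdet : IsUnit (Q.map (Int.cast : ℤ → ℚ)).det := by
    rw [show (Q.map (Int.cast : ℤ → ℚ)).det = (Q.det : ℚ) from
      (RingHom.map_det (Int.castRingHom ℚ) Q).symm]
    exact isUnit_iff_ne_zero.mpr (by exact_mod_cast hQ)
  have h1 : A.map (Int.cast : ℤ → ℚ) * Q.map (Int.cast : ℤ → ℚ) = (N : ℚ) • 1 := by
    rw [← hA, Matrix.smul_mul, ratInv, nonsing_inv_mul _ hdet]
  have h2 : A * Q = (N : ℤ) • 1 := by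
    ext i j
    have h := congrFun (congrFun h1 i) j
    simp only [Matrix.mul_apply, map_apply, Matrix.smul_apply, smul_eq_mul, Matrix.one_apply,
      mul_ite, mul_one, mul_zero] at h ⊢
    split_ifs at h ⊢ <;> exact_mod_cast h
  have h3 : toReal A * toReal Q = (N : ℝ) • 1 := by
    have : toReal A * toReal Q = toReal (A * Q) := (Matrix.map_mul (f := Int.castRingHom ℝ)).symm
    rw [this, h2]
    ext i j
    change (((N : ℤ) * (1 : Matrix (Fin m) (Fin m) ℤ) i j : ℤ) : ℝ) =
      (N : ℝ) * (1 : Matrix (Fin m) (Fin m) ℝ) i j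
    rcases eq_or_ne i j with rfl | h
    · simp
    · simp [h]
  refine inv_eq_left_inv ?_
  rw [Matrix.smul_mul, h3, smul_smul, inv_mul_cancel₀ hN'', one_smul]

theorem toReal_quadVal {m n : ℕ} (A : Matrix (Fin m) (Fin m) ℤ) (V : Matrix (Fin m) (Fin n) ℤ) :
    quadVal (toReal A) (toReal V) = toReal (quadVal A V) := by
  ext i j
  simp [quadVal, Matrix.mul_apply]

theorem gaussTerm_one {m n N : ℕ} (A : Matrix (Fin m) (Fin m) ℤ) (M : Matrix (Fin n) (Fin n) ℤ)
    (V : Matrix (Fin m) (Fin n) ℤ) :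
    gaussTerm A M N 1 V =
      expTrace (toComplex (quadVal ((N : ℝ)⁻¹ • toReal A) (toReal V)) * toComplex (toReal M)) := by
  rw [expTrace_real, gaussTerm, quadVal_smul_left, toReal_quadVal, Matrix.smul_mul, trace_smul,
    traceForm]
  have : (toReal (quadVal A V) * toReal M).trace = ((quadVal A V * M).trace : ℝ) := by
    simp [trace, Matrix.mul_apply]
  rw [this]
  push_cast
  rw [smul_eq_mul]
  push_cast
  congr 1
  ring

/-- With `c = N/q^e`, the exponent matrix is `(N²/q^{2e}) Q⁻¹ = c² A/N`. -/
theorem gaussSum_eq {m n : ℕ} {Q A : Matrix (Fin m) (Fin m) ℤ} (hN : level Q ≠ 0)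
    (hA : (level Q : ℚ) • ratInv Q = A.map (Int.cast : ℤ → ℚ)) (M : Matrix (Fin n) (Fin n) ℤ)
    (q : ℕ) :
    gaussSum Q M q = normalizedGaussSum A M (level Q) (q ^ (level Q).factorization q) := by
  set N := level Q with hNdef
  have hN' : (N : ℚ) ≠ 0 := by exact_mod_cast hN
  have hinv : ratInv Q = (N : ℚ)⁻¹ • A.map (Int.cast : ℤ → ℚ) := by
    rw [← hA, smul_smul, inv_mul_cancel₀ hN', one_smul]
  simp only [gaussSum, normalizedGaussSum, ← hNdef]
  set e := N.factorization q
  congr 1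
  · push_cast
    rw [← pow_mul, mul_assoc]
  refine Finset.sum_congr rfl fun V _ => ?_
  obtain ⟨c, hc⟩ : q ^ e ∣ N := Nat.ordProj_dvd N q
  have hq : q ^ e ≠ 0 := fun h => hN (by rw [hc, h, zero_mul])
  have hdiv : N / q ^ e = c := by
    conv_lhs => rw [hc]
    exact Nat.mul_div_cancel_left _ (Nat.pos_of_ne_zero hq)
  have hqc : (q : ℚ) ^ e ≠ 0 := by exact_mod_cast hq
  have hcoef : (N : ℚ) ^ 2 / (q : ℚ) ^ (2 * e) = (c : ℚ) ^ 2 := by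
    have : (N : ℚ) = (q : ℚ) ^ e * c := by exact_mod_cast hc
    rw [this, mul_comm 2 e, pow_mul]
    field_simp
  have htr : (quadVal (ratInv Q) (V.map fun v => ((v : ℕ) : ℚ)) *
      M.map (Int.cast : ℤ → ℚ)).trace = (traceForm A M (residueRep V) : ℚ) / N := by
    rw [hinv, quadVal_smul_left, Matrix.smul_mul, trace_smul, smul_eq_mul, inv_mul_eq_div]
    congr 1
    simp [traceForm, quadVal, trace, Matrix.mul_apply]
  have htr2 : ∀ B : Matrix (Fin n) (Fin n) ℚ, (B.map (Rat.cast : ℚ → ℂ)).trace = (B.trace : ℂ) :=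
    fun B => by simp [trace]
  rw [gaussTerm, expTrace, htr2, trace_smul, htr, hcoef, hdiv, smul_eq_mul]
  congr 1
  push_cast
  ring

/-! ### The lower triangular transformation. -/

theorem isSymm_of_mem_symplecticGroup {n : ℕ} {M : Matrix (Fin n) (Fin n) ℤ}
    (hM : fromBlocks 1 0 (-M) 1 ∈ symplecticGroup (Fin n) ℤ) : M.IsSymm := by
  rw [SymplecticGroup.mem_iff] at hM
  simp only [J, fromBlocks_transpose, fromBlocks_multiply] at hM
  have h := (fromBlocks_inj.mp hM).2.2.2
  simp only [Matrix.mul_zero, Matrix.mul_one, Matrix.one_mul, zero_add, transpose_neg, add_zero,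
    transpose_one, neg_mul_neg] at h
  exact neg_add_eq_zero.mp h

/-- The translate `M - τ⁻¹` lies in the Siegel upper half-space. -/
theorem sub_inv_mem_siegelUpperHalfSpace {n : ℕ} {M : Matrix (Fin n) (Fin n) ℤ} (hM : M.IsSymm)
    {τ : Matrix (Fin n) (Fin n) ℂ} (hτ : τ ∈ siegelUpperHalfSpace n) :
    toComplex (toReal M) - τ⁻¹ ∈ siegelUpperHalfSpace n := by
  have h := neg_inv_mem_siegelUpperHalfSpace hτ
  refine ⟨?_, ?_⟩
  · have h1 := h.1
    rw [IsSymm, transpose_neg, neg_inj] at h1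
    rw [IsSymm, transpose_sub, h1, ← transpose_map, ← transpose_map, hM]
  · convert h.2 using 1
    ext i j
    simp

theorem det_ratio {n : ℕ} {M τ : Matrix (Fin n) (Fin n) ℂ} (hτ : τ.det ≠ 0) :
    (-I • (M - τ⁻¹)).det = (-M * τ + 1).det * (-I • -τ⁻¹).det := by
  rw [← det_mul]
  congr 1
  have : τ * τ⁻¹ = 1 := mul_nonsing_inv _ (isUnit_iff_ne_zero.mpr hτ)
  rw [Matrix.mul_smul, mul_neg, add_mul, one_mul, mul_assoc, this, mul_one]
  congr 1
  abel

/-- Because `-Mτ + 1 = -(M - τ⁻¹)τ`. -/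
theorem mobius_eq {n : ℕ} {M τ : Matrix (Fin n) (Fin n) ℂ} (hτ : τ.det ≠ 0)
    (hσ : (M - τ⁻¹).det ≠ 0) :
    τ * (-M * τ + 1)⁻¹ = -(M - τ⁻¹)⁻¹ := by
  have h1 : τ⁻¹ * τ = 1 := nonsing_inv_mul _ (isUnit_iff_ne_zero.mpr hτ)
  have h2 : -M * τ + 1 = -(M - τ⁻¹) * τ := by
    rw [neg_mul, neg_mul, sub_mul, h1]
    abel
  have h3 : (-(M - τ⁻¹))⁻¹ = -(M - τ⁻¹)⁻¹ :=
    inv_eq_left_inv (by rw [neg_mul_neg, nonsing_inv_mul _ (isUnit_iff_ne_zero.mpr hσ)])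
  rw [h2, Matrix.mul_inv_rev, ← mul_assoc, mul_nonsing_inv _ (isUnit_iff_ne_zero.mpr hτ), one_mul,
    h3]

/-- A coset of `Nℤ^{m,n}` is rescaled: `S(V + NW) = (N²S)(V/N + W)`, so inversion applies to `N²S`
with translation `V/N`. The power of `N` is `√det(N²S)^n` relative to `√det(S)^n`. -/
theorem tsum_residue_class {k n N : ℕ} (hN : N ≠ 0) {S : Matrix (Fin (2 * k)) (Fin (2 * k)) ℝ}
    (hS : S.PosDef) {τ : Matrix (Fin n) (Fin n) ℂ} (hτ : τ ∈ siegelUpperHalfSpace n)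
    (V : Matrix (Fin (2 * k)) (Fin n) ℤ) :
    ∑' W : Matrix (Fin (2 * k)) (Fin n) ℤ,
        expTrace (toComplex (quadVal S (toReal (V + (N : ℤ) • W))) * τ) =
      ((N : ℂ) ^ (2 * k * n))⁻¹ * ((√S.det ^ n : ℝ) : ℂ)⁻¹ * ((-I • τ).det ^ k)⁻¹ *
        ∑' U : Matrix (Fin (2 * k)) (Fin n) ℤ,
          expTrace (toComplex (quadVal (((N : ℝ) ^ 2)⁻¹ • S⁻¹) (toReal U)) * -τ⁻¹) *
            cexp (2 * Real.pi * I * (((toReal U)ᵀ * ((N : ℝ)⁻¹ • toReal V)).trace : ℝ)) := by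
  have hN0 : (0 : ℝ) < N := by exact_mod_cast Nat.pos_of_ne_zero hN
  have hN2 : (0 : ℝ) < (N : ℝ) ^ 2 := by positivity
  have h := tsum_expTrace_inversion (hS.smul hN2) hτ ((N : ℝ)⁻¹ • toReal V)
  have hinv : ((N : ℝ) ^ 2 • S)⁻¹ = ((N : ℝ) ^ 2)⁻¹ • S⁻¹ := by
    refine inv_eq_left_inv ?_
    rw [Matrix.smul_mul, Matrix.mul_smul, smul_smul, inv_mul_cancel₀ hN2.ne', one_smul,
      nonsing_inv_mul _ (isUnit_iff_ne_zero.mpr hS.det_pos.ne')]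
  have hdet : √((N : ℝ) ^ 2 • S).det ^ n = (N : ℝ) ^ (2 * k * n) * √S.det ^ n := by
    rw [det_smul, Fintype.card_fin, Real.sqrt_mul (by positivity), ← pow_mul, mul_comm 2 (2 * k),
      pow_mul, Real.sqrt_sq (by positivity), mul_pow, ← pow_mul]
  rw [hinv, hdet] at h
  have hterm : ∀ W : Matrix (Fin (2 * k)) (Fin n) ℤ,
      quadVal ((N : ℝ) ^ 2 • S) ((N : ℝ)⁻¹ • toReal V + toReal W) =
        quadVal S (toReal (V + (N : ℤ) • W)) := fun W => by
    rw [quadVal_smul_left, ← quadVal_smul, smul_add, smul_smul, mul_inv_cancel₀ hN0.ne', one_smul]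
    congr 1
    ext i j
    simp
  simp_rw [hterm] at h
  rw [h]
  push_cast
  rw [mul_inv]

/-- The theta series after the lower triangular transformation, as a finite combination of
twisted theta series. -/
theorem slash_theta_eq {k n N : ℕ} (hN : N ≠ 0) {Q A : Matrix (Fin (2 * k)) (Fin (2 * k)) ℤ}
    (hQ : (toReal Q).PosDef) (hA : IsEvenIntegral A)
    (hQA : (toReal Q)⁻¹ = (N : ℝ)⁻¹ • toReal A) {M : Matrix (Fin n) (Fin n) ℤ} (hM : M.IsSymm)
    {τ : Matrix (Fin n) (Fin n) ℂ} (hτ : τ ∈ siegelUpperHalfSpace n) :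
    slash k (theta Q) (fromBlocks 1 0 (-M) 1) τ =
      ((N : ℂ) ^ (2 * k * n))⁻¹ * ∑ V : Matrix (Fin (2 * k)) (Fin n) (Fin N),
        gaussTerm A M N 1 (residueRep V) *
          ∑' U : Matrix (Fin (2 * k)) (Fin n) ℤ,
            expTrace (toComplex (quadVal (((N : ℝ) ^ 2)⁻¹ • toReal Q) (toReal U)) * τ) *
              cexp (2 * Real.pi * I *
                (((toReal U)ᵀ * ((N : ℝ)⁻¹ • toReal (residueRep V))).trace : ℝ)) := by
  have : NeZero N := ⟨hN⟩
  set Mc := toComplex (toReal M) with hMc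
  set σ := Mc - τ⁻¹ with hσdef
  have hσ : σ ∈ siegelUpperHalfSpace n := sub_inv_mem_siegelUpperHalfSpace hM hτ
  have hτd := det_ne_zero_of_mem_siegelUpperHalfSpace hτ
  have hσd := det_ne_zero_of_mem_siegelUpperHalfSpace hσ
  have hτ' := neg_inv_mem_siegelUpperHalfSpace hτ
  have hτi : -(-τ⁻¹)⁻¹ = τ := by
    rw [neg_eq_iff_eq_neg]
    refine inv_eq_left_inv ?_
    rw [neg_mul_neg, mul_nonsing_inv _ (isUnit_iff_ne_zero.mpr hτd)]
  have hS := hQ.inv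
  have hSi : (toReal Q)⁻¹⁻¹ = toReal Q :=
    nonsing_inv_nonsing_inv _ (isUnit_iff_ne_zero.mpr hQ.det_pos.ne')
  set s : ℂ := ((√((toReal Q)⁻¹).det ^ n : ℝ) : ℂ) with hs
  have hs0 : s ≠ 0 := by
    rw [hs]
    exact_mod_cast (pow_pos (Real.sqrt_pos.mpr hS.det_pos) n).ne'
  have hslash : slash k (theta Q) (fromBlocks 1 0 (-M) 1) τ =
      (-Mc * τ + 1).det ^ (-(k : ℤ)) * theta Q (-σ⁻¹) := by
    have hm : (-M).map (Int.cast : ℤ → ℂ) = -Mc := by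
      ext i j
      simp [hMc]
    have h1 : (1 : Matrix (Fin n) (Fin n) ℤ).map (Int.cast : ℤ → ℂ) = 1 := by
      ext i j
      by_cases h : i = j <;> simp [h, Matrix.one_apply]
    simp only [slash, toBlocks_fromBlocks₁₁, toBlocks_fromBlocks₁₂, toBlocks_fromBlocks₂₁,
      toBlocks_fromBlocks₂₂, hm, h1]
    rw [← mobius_eq hτd hσd]
    congr 2
    simp
  -- First inversion, untranslated, for the form `Q⁻¹` at `σ`.
  have hinv1 : ∑' W : Matrix (Fin (2 * k)) (Fin n) ℤ,
      expTrace (toComplex (quadVal (toReal Q)⁻¹ (toReal W)) * σ) =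
        s⁻¹ * ((-I • σ).det ^ k)⁻¹ * theta Q (-σ⁻¹) := by
    have h := tsum_expTrace_inversion hS hσ (0 : Matrix (Fin (2 * k)) (Fin n) ℝ)
    simp only [zero_add, hSi] at h
    rw [h, theta]
    congr 1
    refine tsum_congr fun U => ?_
    rw [thetaTerm_eq_expTrace]
    simp
  have hsplit : ∑' W : Matrix (Fin (2 * k)) (Fin n) ℤ,
      expTrace (toComplex (quadVal (toReal Q)⁻¹ (toReal W)) * σ) =
      ∑ V : Matrix (Fin (2 * k)) (Fin n) (Fin N), gaussTerm A M N 1 (residueRep V) *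
        ∑' W : Matrix (Fin (2 * k)) (Fin n) ℤ, expTrace (toComplex (quadVal (toReal Q)⁻¹
          (toReal (residueRep V + (N : ℤ) • W))) * -τ⁻¹) := by
    rw [tsum_eq_sum_residue (N := N) (summable_expTrace_quadVal hS hσ)]
    refine Finset.sum_congr rfl fun V _ => ?_
    rw [← tsum_mul_left]
    refine tsum_congr fun W => ?_
    -- On each class `e{Q⁻¹(·)σ}` splits as `e{Q⁻¹(·)M}`, constant modulo `N`, times
    -- `e{Q⁻¹(·)(-τ⁻¹)}`.
    rw [← gaussTerm_add_smul hA hM hN (one_mul N) (residueRep V) W, gaussTerm_one, ← hQA,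
      ← expTrace_add, ← mul_add, hσdef, sub_eq_add_neg]
  simp_rw [tsum_residue_class hN hS hτ', hτi, hSi] at hsplit
  rw [hinv1] at hsplit
  have hσI : (-I • σ).det ^ k ≠ 0 := by
    rw [det_smul]
    exact pow_ne_zero _ (mul_ne_zero (pow_ne_zero _ (neg_ne_zero.mpr I_ne_zero)) hσd)
  -- The factor `det(-Mτ+1)^k` gained here cancels the automorphy factor of the slash action; the
  -- remaining determinant cancels that of the second inversion.
  have hratio : (-I • σ).det = (-Mc * τ + 1).det * (-I • -τ⁻¹).det := det_ratio hτd
  have htheta : theta Q (-σ⁻¹) = s * (-I • σ).det ^ k *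
      (s⁻¹ * ((-I • σ).det ^ k)⁻¹ * theta Q (-σ⁻¹)) := by
    field_simp
  rw [hslash, htheta, hsplit, Finset.mul_sum, Finset.mul_sum, Finset.mul_sum]
  refine Finset.sum_congr rfl fun V _ => ?_
  rw [hratio] at hσI ⊢
  rw [mul_pow] at hσI ⊢
  have ha := left_ne_zero_of_mul hσI
  have hb := right_ne_zero_of_mul hσI
  rw [_root_.zpow_neg, zpow_natCast, ← hs]
  field_simp

theorem tendsto_slash_theta {k n N : ℕ} (hN : N ≠ 0)
    {Q A : Matrix (Fin (2 * k)) (Fin (2 * k)) ℤ}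
    (hQ : (toReal Q).PosDef) (hA : IsEvenIntegral A)
    (hQA : (toReal Q)⁻¹ = (N : ℝ)⁻¹ • toReal A) {M : Matrix (Fin n) (Fin n) ℤ} (hM : M.IsSymm) :
    Tendsto (slash k (theta Q) (fromBlocks 1 0 (-M) 1)) (atIInfty n)
      (𝓝 (normalizedGaussSum A M N N)) := by
  have hN0 : (0 : ℝ) < N := by exact_mod_cast Nat.pos_of_ne_zero hN
  have hS : (((N : ℝ) ^ 2)⁻¹ • toReal Q).PosDef := hQ.smul (by positivity)
  have h1 : normalizedGaussSum A M N N = ((N : ℂ) ^ (2 * k * n))⁻¹ *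
      ∑ V : Matrix (Fin (2 * k)) (Fin n) (Fin N), gaussTerm A M N 1 (residueRep V) * 1 := by
    simp only [normalizedGaussSum, Nat.div_self (Nat.pos_of_ne_zero hN), mul_one]
  rw [h1]
  refine Tendsto.congr' (f₁ := fun τ => _) ?_ (Tendsto.const_mul _ (tendsto_finsetSum _
    fun V _ => Tendsto.const_mul _ (tendsto_twisted_theta hS
      (c := fun U => cexp (2 * Real.pi * I *
        (((toReal U)ᵀ * ((N : ℝ)⁻¹ • toReal (residueRep V))).trace : ℝ)))
      (fun U => ?_) ?_)))
  · filter_upwards [eventually_atIInfty 0] with τ hτ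
    exact (slash_theta_eq hN hQ hA hQA hM hτ.1).symm
  · rw [Complex.norm_exp]
    simp
  · simp

end SiegelTheta

end

theorem proposition5p1 (k n : ℕ) (hk : 0 < k) (hn : 0 < n)
    (Q : Matrix (Fin (2 * k)) (Fin (2 * k)) ℤ)
    (hpos : SiegelTheta.IsPositiveDefinite Q) (heven : SiegelTheta.IsEvenIntegral Q)
    (M : Matrix (Fin n) (Fin n) ℤ)
    (hM : Matrix.fromBlocks 1 0 (-M) 1 ∈ Matrix.symplecticGroup (Fin n) ℤ) :
    (∀ τ ∈ SiegelTheta.siegelUpperHalfSpace n, Summable (SiegelTheta.thetaTerm Q τ)) ∧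
    Tendsto (SiegelTheta.slash k (SiegelTheta.theta Q) (Matrix.fromBlocks 1 0 (-M) 1))
      (SiegelTheta.atIInfty n)
      (𝓝 (∏ q ∈ (SiegelTheta.level Q).primeFactors, SiegelTheta.gaussSum Q M q)) := by
  have hQ := hpos.posDef_toReal heven.1
  have hMs := SiegelTheta.isSymm_of_mem_symplecticGroup hM
  obtain ⟨hN, A, hA, hQA⟩ := (SiegelTheta.level_isLeast hpos heven).1
  refine ⟨fun τ hτ => ?_, ?_⟩
  · simp_rw [funext (SiegelTheta.thetaTerm_eq_expTrace Q τ)]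
    exact SiegelTheta.summable_expTrace_quadVal hQ hτ
  · rw [Finset.prod_congr rfl fun q _ => SiegelTheta.gaussSum_eq hN.ne' hQA M q,
      ← SiegelTheta.normalizedGaussSum_eq_prod hA hMs hN.ne']
    exact SiegelTheta.tendsto_slash_theta hN.ne' hQ hA
      (SiegelTheta.toReal_inv_eq hpos.det_ne_zero hN.ne' hQA) hMs
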